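/- Let $X$ be a compact Kähler manifold of arbitrary complex dimension $n$ with Kähler form $\omega$ (a smooth closed positive real $(1,1)$-form), and let $E$ be a holomorphic vector bundle of rank $r$ over $X$. For a Hermitian metric $h$ on $E$ let $F=F_h=\overline{\partial}(h^{-1}\partial h)$ (in local holomorphic frames) be the curvature of the unique unitary connection on $E$ whose $(0,1)$-part is $\overline{\partial}_E$, and let $\Lambda$ be the adjoint of $L(\alpha)=\omega\wedge\alpha$. Fix a constant $\lambda\in\mathbb C$ (for instance $\lambda=-\frac{2\pi n\deg(E)}{\mathrm{rk}(E)\int_X\omega^n}\,i$, the only possible value for which a metric with $\Lambda F=\lambda$ can exist when $X$ is connected and $r>0$), and consider the flow $$h^{-1}\partial_t h=-2i(\Lambda F_{h}-\lambda)$$ for smooth families $h_t$, $t\in[0,\infty)$, of smooth Hermitian metrics on $E$. For Hermitian metrics $g,h$ on $E$ write $g\le h$ if $g(v,v)\le h(v,v)$ for all $v\in E$. Let $(g_t)_{t\ge 0}$ and $(h_t)_{t\ge 0}$ be two solutions of this flow with the same $\lambda$, with $g_0\le h_0$. Then $g_t\le h_t$ for all $t\ge 0$. -/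

import Mathlib

open Set Bundle Manifold Matrix
open scoped ContDiff

noncomputable section

/-! ## Calculus in `ℂⁿ` -/

/-- The coordinate space `ℂⁿ`; it is also the model fibre of bundles of rank `n`. -/
abbrev CSpace (n : ℕ) : Type := EuclideanSpace ℂ (Fin n)

/-- The `j`-th standard basis vector of `ℂⁿ`. -/
def stdVec {n : ℕ} (j : Fin n) : CSpace n := EuclideanSpace.single j 1

/-- The Wirtinger derivative `∂f/∂zⱼ = (∂f/∂xⱼ - i ∂f/∂yⱼ) / 2`. -/
def wirtinger {n : ℕ} (j : Fin n) (f : CSpace n → ℂ) (z : CSpace n) : ℂ :=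
  (fderiv ℝ f z (stdVec j) - Complex.I * fderiv ℝ f z (Complex.I • stdVec j)) / 2

/-- The conjugate Wirtinger derivative `∂f/∂z̄ₖ = (∂f/∂xₖ + i ∂f/∂yₖ) / 2`. -/
def wirtingerBar {n : ℕ} (k : Fin n) (f : CSpace n → ℂ) (z : CSpace n) : ℂ :=
  (fderiv ℝ f z (stdVec k) + Complex.I * fderiv ℝ f z (Complex.I • stdVec k)) / 2

/-- The matrix `∂M/∂zⱼ` of a matrix-valued function `M`. -/
def matWirtinger {n r : ℕ} (j : Fin n) (M : CSpace n → Matrix (Fin r) (Fin r) ℂ)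
    (z : CSpace n) : Matrix (Fin r) (Fin r) ℂ :=
  Matrix.of fun a b => wirtinger j (fun w => M w a b) z

/-- The matrix `∂M/∂z̄ₖ` of a matrix-valued function `M`. -/
def matWirtingerBar {n r : ℕ} (k : Fin n) (M : CSpace n → Matrix (Fin r) (Fin r) ℂ)
    (z : CSpace n) : Matrix (Fin r) (Fin r) ℂ :=
  Matrix.of fun a b => wirtingerBar k (fun w => M w a b) z

/-- The coefficients `α_{jk̄} = α(∂/∂zⱼ, ∂/∂z̄ₖ)` of a real `2`-form `α` at a point of `ℂⁿ`, where
`α` is extended complex-bilinearly and `∂/∂zⱼ = (eⱼ - i (i eⱼ)) / 2`, `∂/∂z̄ₖ = (eₖ + i (i eₖ)) / 2`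
(the inner `i` being the complex structure of `ℂⁿ`). If `α` has type `(1,1)`, then
`α = ∑ α_{jk̄} dzⱼ ∧ dz̄ₖ`. -/
def coeff11 {n : ℕ} (α : CSpace n [⋀^Fin 2]→L[ℝ] ℝ) : Matrix (Fin n) (Fin n) ℂ :=
  Matrix.of fun j k =>
    (((α ![stdVec j, stdVec k] : ℝ) : ℂ)
      + Complex.I * ((α ![stdVec j, Complex.I • stdVec k] : ℝ) : ℂ)
      - Complex.I * ((α ![Complex.I • stdVec j, stdVec k] : ℝ) : ℂ)
      + ((α ![Complex.I • stdVec j, Complex.I • stdVec k] : ℝ) : ℂ)) / 4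

/-- The operator `Λ`, adjoint to `L(f) = f ω`, on the `(1,1)`-forms at a point with values in a
complex vector space: if `W = (ω_{jk̄})` is the coefficient matrix of the positive `(1,1)`-form
`ω = ∑ ω_{jk̄} dzⱼ ∧ dz̄ₖ`, then `Λ (∑ α_{jk̄} dzⱼ ∧ dz̄ₖ) = ∑ (W⁻¹)_{kj} α_{jk̄}`.
See `contraction_adjoint`. -/
def contraction {n : ℕ} {A : Type*} [AddCommGroup A] [Module ℂ A]
    (W : Matrix (Fin n) (Fin n) ℂ) (α : Fin n → Fin n → A) : A :=
  ∑ j, ∑ k, W⁻¹ k j • α j k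

section

open scoped ComplexOrder

/-- `Λ` is the adjoint of `L`: writing `ω = i ∑ g_{jk̄} dzⱼ ∧ dz̄ₖ` with `g` positive definite, the
inner product induced on `(1,1)`-forms is `⟨α, β⟩ = tr (g⁻¹ α g⁻¹ βᴴ)`, and
`⟨α, L c⟩ = ⟨Λ α, c⟩` for scalars `c`. -/
theorem contraction_adjoint {n : ℕ} (g : Matrix (Fin n) (Fin n) ℂ) (hg : g.PosDef)
    (α : Matrix (Fin n) (Fin n) ℂ) (c : ℂ) :
    (g⁻¹ * α * g⁻¹ * (c • Complex.I • g)ᴴ).trace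
      = contraction (Complex.I • g) (fun j k => α j k) * star c := by
  have hu : IsUnit g.det := (Matrix.isUnit_iff_isUnit_det g).1 hg.isUnit
  have hinv : (Complex.I • g)⁻¹ = (-Complex.I) • g⁻¹ := by
    apply Matrix.inv_eq_right_inv
    rw [Matrix.smul_mul, Matrix.mul_smul, smul_smul, Matrix.mul_nonsing_inv _ hu]
    simp
  have hH : gᴴ = g := hg.isHermitian
  have h1 : contraction (Complex.I • g) (fun j k => α j k) = -Complex.I * (g⁻¹ * α).trace := by
    unfold contraction
    rw [hinv, Finset.sum_comm]
    simp [Matrix.trace, Matrix.mul_apply, Finset.mul_sum, mul_assoc]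
  rw [h1, Matrix.conjTranspose_smul, Matrix.conjTranspose_smul, hH, Matrix.mul_smul,
    Matrix.mul_smul, Matrix.mul_assoc (g⁻¹ * α), Matrix.nonsing_inv_mul _ hu]
  simp
  ring

end

/-! ## Kähler forms -/

/-- The expression of a field of real `2`-forms on `X` in a chart `φ`. -/
def chartForm {n : ℕ} {X : Type*} [TopologicalSpace X] [ChartedSpace (CSpace n) X]
    (η : ∀ x : X, TangentSpace 𝓘(ℂ, CSpace n) x [⋀^Fin 2]→L[ℝ] ℝ)
    (φ : OpenPartialHomeomorph X (CSpace n)) (z : CSpace n) : CSpace n [⋀^Fin 2]→L[ℝ] ℝ :=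
  (η (φ.symm z)).compContinuousLinearMap
    ((mfderiv 𝓘(ℂ, CSpace n) 𝓘(ℂ, CSpace n) φ.symm z).restrictScalars ℝ)

/-- A Kähler form on a complex manifold `X` of dimension `n`: a smooth closed positive real
`(1,1)`-form. -/
structure KahlerForm (n : ℕ) (X : Type*) [TopologicalSpace X] [ChartedSpace (CSpace n) X] where
  /-- the underlying real `2`-form -/
  form : ∀ x : X, TangentSpace 𝓘(ℂ, CSpace n) x [⋀^Fin 2]→L[ℝ] ℝ
  type11 : ∀ (x : X) (u v : TangentSpace 𝓘(ℂ, CSpace n) x),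
    form x ![Complex.I • u, Complex.I • v] = form x ![u, v]
  pos : ∀ (x : X) (u : TangentSpace 𝓘(ℂ, CSpace n) x), u ≠ 0 → 0 < form x ![u, Complex.I • u]
  smooth : ∀ φ ∈ atlas (CSpace n) X, ContDiffOn ℝ ∞ (chartForm form φ) φ.target
  closed : ∀ φ ∈ atlas (CSpace n) X, ∀ z ∈ φ.target, extDeriv (chartForm form φ) z = 0

/-! ## Hermitian metrics on holomorphic vector bundles -/

section Bundle

variable {n r : ℕ} {X : Type*} [TopologicalSpace X] [ChartedSpace (CSpace n) X]
  {E : X → Type*} [TopologicalSpace (TotalSpace (CSpace r) E)]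
  [∀ x, AddCommGroup (E x)] [∀ x, Module ℂ (E x)]

/-- The open set in `ℂⁿ` of coordinates of points in the domains of both the chart `φ` and the
local trivialization `e`. -/
def localDomain (φ : OpenPartialHomeomorph X (CSpace n))
    (e : Trivialization (CSpace r) (π (CSpace r) E)) : Set (CSpace n) :=
  φ.target ∩ φ.symm ⁻¹' e.baseSet

/-- The local holomorphic frame `s₁, …, s_r` defined by the local trivialization `e`. -/
def localFrame (e : Trivialization (CSpace r) (π (CSpace r) E)) (a : Fin r) (x : X) : E x :=
  e.symm x (stdVec a)

/-- The matrix `H` of a field of sesquilinear forms (linear in the first, conjugate-linear in the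
second variable) in the frame of `e` and the coordinates of `φ`: `H a b = h(s_b, s_a)`, so that
`h(v, w) = w* H v` for coefficient columns `v`, `w`. -/
def localMatrix (h : ∀ x, E x →ₗ[ℂ] E x →ₛₗ[starRingEnd ℂ] ℂ)
    (φ : OpenPartialHomeomorph X (CSpace n))
    (e : Trivialization (CSpace r) (π (CSpace r) E)) (z : CSpace n) :
    Matrix (Fin r) (Fin r) ℂ :=
  Matrix.of fun a b =>
    h (φ.symm z) (localFrame e b (φ.symm z)) (localFrame e a (φ.symm z))

end Bundle

/-- A (smooth) Hermitian metric on the vector bundle `E` of rank `r` over `X`. -/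
structure HermitianMetric (n r : ℕ) {X : Type*} [TopologicalSpace X] [ChartedSpace (CSpace n) X]
    (E : X → Type*) [TopologicalSpace (TotalSpace (CSpace r) E)] [∀ x, TopologicalSpace (E x)]
    [∀ x, AddCommGroup (E x)] [∀ x, Module ℂ (E x)] [FiberBundle (CSpace r) E] where
  /-- the sesquilinear form on each fibre -/
  form : ∀ x, E x →ₗ[ℂ] E x →ₛₗ[starRingEnd ℂ] ℂ
  symm : ∀ (x : X) (v w : E x), form x v w = star (form x w v)
  pos : ∀ (x : X) (v : E x), v ≠ 0 → 0 < (form x v v).re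
  smooth : ∀ φ ∈ atlas (CSpace n) X,
    ∀ (e : Trivialization (CSpace r) (π (CSpace r) E)) [MemTrivializationAtlas e] (a b : Fin r),
      ContDiffOn ℝ ∞ (fun z => localMatrix form φ e z a b) (localDomain φ e)

section Flow

variable {n r : ℕ} {X : Type*} [TopologicalSpace X] [ChartedSpace (CSpace n) X]
  {E : X → Type*} [TopologicalSpace (TotalSpace (CSpace r) E)] [∀ x, TopologicalSpace (E x)]
  [∀ x, AddCommGroup (E x)] [∀ x, Module ℂ (E x)] [FiberBundle (CSpace r) E]

/-- The pointwise partial order: `g ≤ h` iff `g(v, v) ≤ h(v, v)` for all `v ∈ E`. -/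
instance HermitianMetric.instLE : LE (HermitianMetric n r E) where
  le g h := ∀ (x : X) (v : E x), (g.form x v v).re ≤ (h.form x v v).re

/-- The coefficients `A_j = H⁻¹ ∂H/∂zⱼ` of the connection matrix `A = H⁻¹ ∂H = ∑ A_j dzⱼ` of the
unitary connection compatible with the holomorphic structure, for a metric with matrix `H` in a
local holomorphic frame. -/
def connCoeff (H : CSpace n → Matrix (Fin r) (Fin r) ℂ) (j : Fin n) (z : CSpace n) :
    Matrix (Fin r) (Fin r) ℂ :=
  (H z)⁻¹ * matWirtinger j H z

/-- The coefficients of the curvature `F = ∂̄(H⁻¹ ∂H) = ∑ F_{jk̄} dzⱼ ∧ dz̄ₖ`. As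
`∂̄ (∑ A_j dzⱼ) = ∑ (∂A_j/∂z̄ₖ) dz̄ₖ ∧ dzⱼ`, they are `F_{jk̄} = - ∂A_j/∂z̄ₖ`. -/
def curvCoeff (H : CSpace n → Matrix (Fin r) (Fin r) ℂ) (z : CSpace n) (j k : Fin n) :
    Matrix (Fin r) (Fin r) ℂ :=
  -matWirtingerBar k (connCoeff H j) z

/-- `h_t`, `t ≥ 0`, is a (smooth) solution of the flow `h⁻¹ ∂ₜh = -2i (ΛF - lam)` with respect to
the Kähler form `κ`: the metrics depend smoothly on `(t, x) ∈ [0, ∞) × X`, and the equation holds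
at every `t ≥ 0` in all local holomorphic coordinates and frames. Values of `h` at negative times
play no role. -/
structure IsDonaldsonFlow (κ : KahlerForm n X) (lam : ℂ) (h : ℝ → HermitianMetric n r E) :
    Prop where
  smooth : ∀ φ ∈ atlas (CSpace n) X,
    ∀ (e : Trivialization (CSpace r) (π (CSpace r) E)) [MemTrivializationAtlas e] (a b : Fin r),
      ContDiffOn ℝ ∞ (fun p : ℝ × CSpace n => localMatrix (h p.1).form φ e p.2 a b)
        (Ici (0 : ℝ) ×ˢ localDomain φ e)
  equation : ∀ t : ℝ, 0 ≤ t → ∀ φ ∈ atlas (CSpace n) X,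
    ∀ (e : Trivialization (CSpace r) (π (CSpace r) E)) [MemTrivializationAtlas e],
      ∀ z ∈ localDomain φ e,
        (localMatrix (h t).form φ e z)⁻¹ *
            (Matrix.of fun a b =>
              derivWithin (fun s => localMatrix (h s).form φ e z a b) (Ici (0 : ℝ)) t)
          = (-2 * Complex.I) •
              (contraction (coeff11 (chartForm κ.form φ z))
                  (curvCoeff (localMatrix (h t).form φ e) z)
                - lam • (1 : Matrix (Fin r) (Fin r) ℂ))

end Flow

end

/-! The proof is a maximum principle for `g - μ h`, where `μ(t) = 1 + ε (1 + t)` and `ε > 0`. This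
factor exceeds `1` at time `0`, which makes the initial inequality strict, and it has positive
derivative, which makes the evolution inequality strict.

Suppose that `g ≤ μ h` up to a time `t₀ > 0`, with equality at `t₀` on a vector `v ≠ 0` over `x`.
Choose a local holomorphic section `s` with `s(x) = v` whose `h`-covariant derivative vanishes at
`x`. The function `μ |s|_h² - |s|_g²` has a local minimum at `x`, so its second derivatives of type
`∂_b̄ ∂_b` are nonnegative there. Each `∂_b̄ ∂_b |s|²` is a curvature term plus the square length of
the covariant derivative. The latter is zero for `h` and nonnegative for `g`, so the curvature term
of `g` at `v` is at most `μ` times that of `h` (`curvature_le_of_touching`).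

Diagonalizing the inverse of the Kähler form writes the flow as `∂ₜH = 2 ∑ H ∂̄_b(H⁻¹ ∂_b H) + 2iλ
H`, summed over finitely many directions `b` (`coeff11_inv_eq_sum`, `flow_derivative_eq`). At the
touching vector the `λ` terms cancel, so the time derivative of `g(v, v) - μ h(v, v)` is at most `-ε
h(v, v) < 0`. Since this function is nonpositive before `t₀` and zero at `t₀`, that is impossible
(`no_first_touching`).

Compactness of `X` and of the unit sphere makes strict comparison an open condition in time, so it
never fails (`lt_of_initial_le`). Letting `ε → 0` gives the theorem. -/

/-! ## Directional Wirtinger derivatives -/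

/-- The derivative `∑ bⱼ ∂f/∂zⱼ` of type `(1,0)` in the direction `b`. -/
noncomputable def dirD {n : ℕ} (b : CSpace n) (f : CSpace n → ℂ) (z : CSpace n) : ℂ :=
  (fderiv ℝ f z b - Complex.I * fderiv ℝ f z (Complex.I • b)) / 2

/-- The derivative `∑ b̄ₖ ∂f/∂z̄ₖ` of type `(0,1)` in the direction `b`. -/
noncomputable def dirDbar {n : ℕ} (b : CSpace n) (f : CSpace n → ℂ) (z : CSpace n) : ℂ :=
  (fderiv ℝ f z b + Complex.I * fderiv ℝ f z (Complex.I • b)) / 2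

section Wirtinger

variable {n : ℕ} {f g : CSpace n → ℂ} {z : CSpace n}

theorem fderiv_complex_smul (c : ℂ) (b : CSpace n) :
    fderiv ℝ f z (c • b) = c.re * fderiv ℝ f z b + c.im * fderiv ℝ f z (Complex.I • b) := by
  have h : c • b = c.re • b + c.im • (Complex.I • b) := by
    conv_lhs => rw [← Complex.re_add_im c]
    rw [add_smul, mul_smul]
    rfl
  rw [h, map_add, map_smul, map_smul]
  simp

theorem dirD_smul (c : ℂ) (b : CSpace n) : dirD (c • b) f z = c * dirD b f z := by
  have h : Complex.I • c • b = (Complex.I * c) • b := smul_smul _ _ _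
  unfold dirD
  rw [h, fderiv_complex_smul c b, fderiv_complex_smul (Complex.I * c) b]
  have hc : c = c.re + c.im * Complex.I := (Complex.re_add_im c).symm
  generalize c.re = x, c.im = y at hc
  subst hc
  simp
  ring_nf
  simp
  ring

theorem dirDbar_smul (c : ℂ) (b : CSpace n) : dirDbar (c • b) f z = star c * dirDbar b f z := by
  have h : Complex.I • c • b = (Complex.I * c) • b := smul_smul _ _ _
  have hc : star c = c.re - c.im * Complex.I := by
    apply Complex.ext <;> simp
  unfold dirDbar
  rw [h, fderiv_complex_smul c b, fderiv_complex_smul (Complex.I * c) b, hc]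
  simp
  ring_nf
  simp
  ring

theorem dirD_sum_left {ι : Type*} (s : Finset ι) (b : ι → CSpace n) :
    dirD (∑ i ∈ s, b i) f z = ∑ i ∈ s, dirD (b i) f z := by
  simp only [dirD, Finset.smul_sum, map_sum, Finset.mul_sum, ← Finset.sum_sub_distrib,
    Finset.sum_div]

theorem dirDbar_sum_left {ι : Type*} (s : Finset ι) (b : ι → CSpace n) :
    dirDbar (∑ i ∈ s, b i) f z = ∑ i ∈ s, dirDbar (b i) f z := by
  simp only [dirDbar, Finset.smul_sum, map_sum, Finset.mul_sum, ← Finset.sum_add_distrib,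
    Finset.sum_div]

theorem sum_smul_stdVec (b : CSpace n) : ∑ j, b j • stdVec j = b := by
  ext k
  simp [stdVec, Pi.single_apply]

theorem dirD_eq_sum (b : CSpace n) : dirD b f z = ∑ j, b j * wirtinger j f z := by
  conv_lhs => rw [← sum_smul_stdVec b]
  rw [dirD_sum_left]
  exact Finset.sum_congr rfl fun j _ => dirD_smul _ _

theorem dirDbar_eq_sum (b : CSpace n) : dirDbar b f z = ∑ k, star (b k) * wirtingerBar k f z := by
  conv_lhs => rw [← sum_smul_stdVec b]
  rw [dirDbar_sum_left]
  exact Finset.sum_congr rfl fun j _ => dirDbar_smul _ _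

theorem dirDbar_congr {b : CSpace n} (h : f =ᶠ[nhds z] g) : dirDbar b f z = dirDbar b g z := by
  simp only [dirDbar, h.fderiv_eq]

theorem dirD_mul (b : CSpace n) (hf : DifferentiableAt ℝ f z) (hg : DifferentiableAt ℝ g z) :
    dirD b (fun w => f w * g w) z = dirD b f z * g z + f z * dirD b g z := by
  simp only [dirD, fderiv_fun_mul hf hg, _root_.add_apply,
    _root_.smul_apply, smul_eq_mul]
  ring

theorem dirDbar_mul (b : CSpace n) (hf : DifferentiableAt ℝ f z) (hg : DifferentiableAt ℝ g z) :
    dirDbar b (fun w => f w * g w) z = dirDbar b f z * g z + f z * dirDbar b g z := by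
  simp only [dirDbar, fderiv_fun_mul hf hg, _root_.add_apply,
    _root_.smul_apply, smul_eq_mul]
  ring

theorem dirD_sum {ι : Type*} (s : Finset ι) {F : ι → CSpace n → ℂ} (b : CSpace n)
    (hF : ∀ i ∈ s, DifferentiableAt ℝ (F i) z) :
    dirD b (fun w => ∑ i ∈ s, F i w) z = ∑ i ∈ s, dirD b (F i) z := by
  simp only [dirD, fderiv_fun_sum hF, _root_.sum_apply, Finset.mul_sum,
    ← Finset.sum_sub_distrib, Finset.sum_div]

theorem dirDbar_sum {ι : Type*} (s : Finset ι) {F : ι → CSpace n → ℂ} (b : CSpace n)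
    (hF : ∀ i ∈ s, DifferentiableAt ℝ (F i) z) :
    dirDbar b (fun w => ∑ i ∈ s, F i w) z = ∑ i ∈ s, dirDbar b (F i) z := by
  simp only [dirDbar, fderiv_fun_sum hF, _root_.sum_apply, Finset.mul_sum,
    ← Finset.sum_add_distrib, Finset.sum_div]

theorem fderiv_star_apply (hf : DifferentiableAt ℝ f z) (b : CSpace n) :
    fderiv ℝ (fun w => star (f w)) z b = star (fderiv ℝ f z b) := by
  have h : HasFDerivAt (fun w => star (f w))
      ((Complex.conjCLE : ℂ →L[ℝ] ℂ).comp (fderiv ℝ f z)) z :=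
    (Complex.conjCLE : ℂ →L[ℝ] ℂ).hasFDerivAt.comp z hf.hasFDerivAt
  rw [h.fderiv]
  simp

theorem dirDbar_star (b : CSpace n) (hf : DifferentiableAt ℝ f z) :
    dirDbar b (fun w => star (f w)) z = star (dirD b f z) := by
  simp only [dirDbar, dirD, fderiv_star_apply hf]
  simp

theorem dirD_star (b : CSpace n) (hf : DifferentiableAt ℝ f z) :
    dirD b (fun w => star (f w)) z = star (dirDbar b f z) := by
  simp only [dirDbar, dirD, fderiv_star_apply hf]
  simp [sub_eq_add_neg]

theorem dirD_sub (b : CSpace n) (hf : DifferentiableAt ℝ f z) (hg : DifferentiableAt ℝ g z) :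
    dirD b (fun w => f w - g w) z = dirD b f z - dirD b g z := by
  simp only [dirD, fderiv_fun_sub hf hg, _root_.sub_apply]
  ring

theorem dirDbar_sub (b : CSpace n) (hf : DifferentiableAt ℝ f z) (hg : DifferentiableAt ℝ g z) :
    dirDbar b (fun w => f w - g w) z = dirDbar b f z - dirDbar b g z := by
  simp only [dirDbar, fderiv_fun_sub hf hg, _root_.sub_apply]
  ring

theorem dirD_const_mul (b : CSpace n) (c : ℂ) (hf : DifferentiableAt ℝ f z) :
    dirD b (fun w => c * f w) z = c * dirD b f z := by
  simp only [dirD, fderiv_const_mul hf, _root_.smul_apply, smul_eq_mul]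
  ring

theorem dirDbar_const_mul (b : CSpace n) (c : ℂ) (hf : DifferentiableAt ℝ f z) :
    dirDbar b (fun w => c * f w) z = c * dirDbar b f z := by
  simp only [dirDbar, fderiv_const_mul hf, _root_.smul_apply, smul_eq_mul]
  ring

/-- Affine functions with complex-linear slope serve as the coefficients of holomorphic test
sections: they prescribe the value and the first derivative at a point. -/
theorem fderiv_affine (ℓ : CSpace n →L[ℂ] ℂ) (c : ℂ) (z₀ b : CSpace n) :
    fderiv ℝ (fun w => c + ℓ (w - z₀)) z b = ℓ b := by
  have h : HasFDerivAt (fun w => c + ℓ (w - z₀)) (ℓ.restrictScalars ℝ) z := by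
    have h1 := ((ℓ.restrictScalars ℝ).hasFDerivAt (x := z - z₀)).comp z
      ((hasFDerivAt_id (𝕜 := ℝ) z).sub_const z₀)
    exact h1.const_add c
  rw [h.fderiv]
  rfl

theorem differentiable_affine (ℓ : CSpace n →L[ℂ] ℂ) (c : ℂ) (z₀ : CSpace n) :
    Differentiable ℝ (fun w => c + ℓ (w - z₀)) := by
  have h : Differentiable ℝ (fun w => (ℓ.restrictScalars ℝ) (w - z₀)) :=
    (ℓ.restrictScalars ℝ).differentiable.comp (differentiable_id.sub_const z₀)
  exact h.const_add c

theorem dirD_affine (ℓ : CSpace n →L[ℂ] ℂ) (c : ℂ) (z₀ b : CSpace n) :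
    dirD b (fun w => c + ℓ (w - z₀)) z = ℓ b := by
  simp only [dirD, fderiv_affine, map_smul, smul_eq_mul]
  ring_nf
  simp
  ring

theorem dirDbar_affine (ℓ : CSpace n →L[ℂ] ℂ) (c : ℂ) (z₀ b : CSpace n) :
    dirDbar b (fun w => c + ℓ (w - z₀)) z = 0 := by
  simp only [dirDbar, fderiv_affine, map_smul, smul_eq_mul]
  ring_nf
  simp

theorem ContDiffAt.differentiableAt_fderiv_apply (hf : ContDiffAt ℝ 2 f z) (b : CSpace n) :
    DifferentiableAt ℝ (fun w => fderiv ℝ f w b) z :=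
  ((hf.fderiv_right (m := 1) (by norm_num)).differentiableAt (by norm_num)).clm_apply
    (differentiableAt_const b)

theorem ContDiffAt.differentiableAt_dirD (hf : ContDiffAt ℝ 2 f z) (b : CSpace n) :
    DifferentiableAt ℝ (dirD b f) z := by
  have h1 := hf.differentiableAt_fderiv_apply b
  have h2 := hf.differentiableAt_fderiv_apply (Complex.I • b)
  unfold dirD
  simp only [div_eq_mul_inv]
  exact (h1.sub (h2.const_mul Complex.I)).mul_const _

theorem ContDiffAt.eventually_differentiableAt (hf : ContDiffAt ℝ 2 f z) :
    ∀ᶠ w in nhds z, DifferentiableAt ℝ f w :=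
  (hf.eventually (by simp)).mono fun _ h => h.differentiableAt (by norm_num)

end Wirtinger

/-! ## The second derivative test -/

/-- A negative second derivative would make the point a local maximum as well, so `f` would be
constant nearby and its second derivative zero. -/
theorem IsLocalMin.deriv_deriv_nonneg {f : ℝ → ℝ} {x : ℝ} (h : IsLocalMin f x)
    (hc : ContinuousAt f x) : 0 ≤ deriv (deriv f) x := by
  by_contra! hneg
  have hmax := isLocalMax_of_deriv_deriv_neg hneg h.deriv_eq_zero hc
  have hconst : f =ᶠ[nhds x] fun _ => f x := by
    filter_upwards [h, hmax] with y h1 h2 using le_antisymm h2 h1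
  have h1 : deriv f =ᶠ[nhds x] fun _ => 0 := by
    simpa using hconst.deriv
  have h2 : deriv (deriv f) x = 0 := by simpa using h1.deriv_eq
  linarith

theorem IsLocalMin.fderiv_fderiv_nonneg {n : ℕ} {f : CSpace n → ℝ} {z : CSpace n}
    (h : IsLocalMin f z) (hf : ContDiffAt ℝ 2 f z) (b : CSpace n) :
    0 ≤ fderiv ℝ (fun w => fderiv ℝ f w b) z b := by
  have hline : ∀ t : ℝ, HasDerivAt (fun s : ℝ => z + s • b) b t := fun t => by
    simpa using ((hasDerivAt_id t).smul_const b).const_add z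
  have hz : z + (0 : ℝ) • b = z := by simp
  have htend : Filter.Tendsto (fun s : ℝ => z + s • b) (nhds 0) (nhds z) := by
    simpa using (hline 0).continuousAt.tendsto
  have hmin : IsLocalMin (fun s : ℝ => f (z + s • b)) 0 := by
    unfold IsLocalMin IsMinFilter
    simpa using htend.eventually h
  have hd : ∀ᶠ w in nhds z, DifferentiableAt ℝ f w :=
    (hf.eventually (by simp)).mono fun _ h => h.differentiableAt (by norm_num)
  have h1 : deriv (fun s : ℝ => f (z + s • b)) =ᶠ[nhds 0]
      fun s => fderiv ℝ f (z + s • b) b := by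
    filter_upwards [htend.eventually hd] with s hs
    exact (hs.hasFDerivAt.comp_hasDerivAt s (hline s)).deriv
  have hdd : DifferentiableAt ℝ (fun w => fderiv ℝ f w b) z :=
    ((hf.fderiv_right (m := 1) (by norm_num)).differentiableAt (by norm_num)).clm_apply
      (differentiableAt_const b)
  have h2 : deriv (deriv (fun s : ℝ => f (z + s • b))) 0
      = fderiv ℝ (fun w => fderiv ℝ f w b) z b := by
    rw [h1.deriv_eq]
    have h3 : HasFDerivAt (fun w => fderiv ℝ f w b) (fderiv ℝ (fun w => fderiv ℝ f w b) z)
        (z + (0 : ℝ) • b) := by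
      rw [hz]; exact hdd.hasFDerivAt
    exact (h3.comp_hasDerivAt (0 : ℝ) (hline 0)).deriv
  rw [← h2]
  refine hmin.deriv_deriv_nonneg ?_
  have h4 : ContinuousAt f (z + (0 : ℝ) • b) := by rw [hz]; exact hf.continuousAt
  exact ContinuousAt.comp (f := fun s : ℝ => z + s • b) h4 (hline 0).continuousAt

/-- The operator `∂_b̄ ∂_b` is a quarter of the Laplacian on the real plane spanned by `b` and `i
b`, because the mixed second derivatives cancel by symmetry. Both remaining terms are nonnegative at
a minimum. -/
theorem re_dirDbar_dirD_nonneg {n : ℕ} {f : CSpace n → ℂ} {z : CSpace n}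
    (hf : ContDiffAt ℝ 2 f z) (h : IsLocalMin (fun w => (f w).re) z) (b : CSpace n) :
    0 ≤ (dirDbar b (dirD b f) z).re := by
  have hre : ContDiffAt ℝ 2 (fun w => (f w).re) z :=
    Complex.reCLM.contDiff.contDiffAt.comp z hf
  have key : ∀ c : CSpace n, 0 ≤ (fderiv ℝ (fun w => fderiv ℝ f w c) z c).re := fun c => by
    have h1 : (fun w => fderiv ℝ (fun w => (f w).re) w c) =ᶠ[nhds z]
        fun w => (fderiv ℝ f w c).re := by
      filter_upwards [hf.eventually_differentiableAt] with w hw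
      have := (Complex.reCLM.hasFDerivAt (x := f w)).comp w hw.hasFDerivAt
      have h2 : fderiv ℝ (fun w => (f w).re) w = Complex.reCLM.comp (fderiv ℝ f w) := this.fderiv
      rw [h2]; rfl
    have h3 := h.fderiv_fderiv_nonneg hre c
    rw [h1.fderiv_eq] at h3
    have h4 := (Complex.reCLM.hasFDerivAt (x := fderiv ℝ f z c)).comp z
      (hf.differentiableAt_fderiv_apply c).hasFDerivAt
    have h5 : fderiv ℝ (fun w => (fderiv ℝ f w c).re) z
      = Complex.reCLM.comp (fderiv ℝ (fun w => fderiv ℝ f w c) z) := h4.fderiv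
    rw [h5] at h3
    exact h3
  have hb := hf.differentiableAt_fderiv_apply b
  have hib := hf.differentiableAt_fderiv_apply (Complex.I • b)
  have hsym : fderiv ℝ (fun w => fderiv ℝ f w b) z (Complex.I • b)
      = fderiv ℝ (fun w => fderiv ℝ f w (Complex.I • b)) z b := by
    have hs := hf.isSymmSndFDerivAt (by simp)
    have hd := (hf.fderiv_right (m := 1) (by norm_num)).differentiableAt (by norm_num)
    rw [fderiv_clm_apply hd (differentiableAt_const _),
      fderiv_clm_apply hd (differentiableAt_const _)]
    simpa using hs (Complex.I • b) b
  have hexp : ∀ c, fderiv ℝ (dirD b f) z c = (fderiv ℝ (fun w => fderiv ℝ f w b) z c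
      - Complex.I * fderiv ℝ (fun w => fderiv ℝ f w (Complex.I • b)) z c) / 2 := fun c => by
    have h6 := ((hb.hasFDerivAt.sub (hib.hasFDerivAt.const_mul Complex.I)).mul_const
      ((2 : ℂ)⁻¹)).fderiv
    have h7 : dirD b f = fun w => (fderiv ℝ f w b - Complex.I * fderiv ℝ f w (Complex.I • b))
      * (2 : ℂ)⁻¹ := by
      funext w; rw [dirD, div_eq_mul_inv]
    rw [h7]
    refine (congrArg (fun T => T c) h6).trans ?_
    simp
    ring
  have hfin : dirDbar b (dirD b f) z = (fderiv ℝ (fun w => fderiv ℝ f w b) z b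
      + fderiv ℝ (fun w => fderiv ℝ f w (Complex.I • b)) z (Complex.I • b)) / 4 := by
    rw [dirDbar, hexp, hexp, hsym]
    ring_nf
    simp
    ring
  have h8 := key b
  have h9 := key (Complex.I • b)
  rw [hfin]
  have : ((4 : ℂ)) = ((4 : ℝ) : ℂ) := by norm_num
  rw [this, Complex.div_ofReal_re, Complex.add_re]
  positivity

/-! ## Matrix-valued functions -/

section MatrixCalculus

variable {n r : ℕ}

/-- The entrywise derivative of type `(1,0)` in the direction `b`. -/
noncomputable def matD (b : CSpace n) (M : CSpace n → Matrix (Fin r) (Fin r) ℂ) (z : CSpace n) :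
    Matrix (Fin r) (Fin r) ℂ :=
  Matrix.of fun a c => dirD b (fun w => M w a c) z

/-- The entrywise derivative of type `(0,1)` in the direction `b`. -/
noncomputable def matDbar (b : CSpace n) (M : CSpace n → Matrix (Fin r) (Fin r) ℂ) (z : CSpace n) :
    Matrix (Fin r) (Fin r) ℂ :=
  Matrix.of fun a c => dirDbar b (fun w => M w a c) z

variable {H M N : CSpace n → Matrix (Fin r) (Fin r) ℂ} {z : CSpace n} {b : CSpace n}

theorem matDbar_mul (hM : ∀ a c, DifferentiableAt ℝ (fun w => M w a c) z)
    (hN : ∀ a c, DifferentiableAt ℝ (fun w => N w a c) z) :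
    matDbar b (fun w => M w * N w) z = matDbar b M z * N z + M z * matDbar b N z := by
  ext a c
  simp only [matDbar, Matrix.of_apply, Matrix.add_apply, Matrix.mul_apply]
  rw [dirDbar_sum _ _ fun k _ => (hM a k).fun_mul (hN k c), ← Finset.sum_add_distrib]
  exact Finset.sum_congr rfl fun k _ => dirDbar_mul b (hM a k) (hN k c)

theorem matDbar_congr (h : M =ᶠ[nhds z] N) : matDbar b M z = matDbar b N z := by
  ext a c
  exact dirDbar_congr (h.mono fun w hw => by simp only [hw])

theorem matDbar_eq_conjTranspose (hM : ∀ a c, DifferentiableAt ℝ (fun w => M w a c) z)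
    (hherm : ∀ᶠ w in nhds z, (M w).IsHermitian) : matDbar b M z = (matD b M z)ᴴ := by
  ext a c
  rw [Matrix.conjTranspose_apply, matD, matDbar, Matrix.of_apply, Matrix.of_apply,
    ← dirDbar_star b (hM c a)]
  exact dirDbar_congr (hherm.mono fun w hw => (hw.apply a c).symm)

theorem differentiableAt_det {m : ℕ} {P : CSpace n → Matrix (Fin m) (Fin m) ℂ}
    (hP : ∀ a c, DifferentiableAt ℝ (fun w => P w a c) z) :
    DifferentiableAt ℝ (fun w => (P w).det) z := by
  simp only [Matrix.det_apply']
  exact DifferentiableAt.fun_sum fun σ _ =>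
    (HasFDerivAt.finsetProd fun i _ => (hP (σ i) i).hasFDerivAt).differentiableAt.const_mul _

/-- By Cramer's rule the entries of the inverse are cofactors divided by the determinant. -/
theorem differentiableAt_matrix_inv (hM : ∀ a c, DifferentiableAt ℝ (fun w => M w a c) z)
    (hu : IsUnit (M z).det) (a c : Fin r) : DifferentiableAt ℝ (fun w => (M w)⁻¹ a c) z := by
  have hadj : DifferentiableAt ℝ (fun w => (M w).adjugate a c) z := by
    simp only [Matrix.adjugate_apply]
    refine differentiableAt_det fun i j => ?_
    simp only [Matrix.updateRow_apply]
    split_ifs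
    · exact differentiableAt_const _
    · exact hM i j
  simp only [Matrix.inv_def, Matrix.smul_apply, Ring.inverse_eq_inv', smul_eq_mul]
  exact ((differentiableAt_det hM).fun_inv hu.ne_zero).mul hadj

theorem differentiableAt_matD (hM : ∀ a c, ContDiffAt ℝ 2 (fun w => M w a c) z) (a c : Fin r) :
    DifferentiableAt ℝ (fun w => matD b M w a c) z :=
  (hM a c).differentiableAt_dirD b

theorem differentiableAt_inv_mul_matD (hM : ∀ a c, ContDiffAt ℝ 2 (fun w => M w a c) z)
    (hu : IsUnit (M z).det) (a c : Fin r) :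
    DifferentiableAt ℝ (fun w => ((M w)⁻¹ * matD b M w) a c) z := by
  simp only [Matrix.mul_apply]
  exact DifferentiableAt.fun_sum fun k _ =>
    (differentiableAt_matrix_inv (fun a c => (hM a c).differentiableAt (by norm_num)) hu a k).mul
      (differentiableAt_matD hM k c)

theorem eventually_isUnit_det (hM : ∀ a c, DifferentiableAt ℝ (fun w => M w a c) z)
    (hu : IsUnit (M z).det) : ∀ᶠ w in nhds z, IsUnit (M w).det :=
  ((differentiableAt_det hM).continuousAt.eventually_ne hu.ne_zero).mono
    fun _ h => isUnit_iff_ne_zero.2 h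

/-- `H ∂̄(H⁻¹ ∂H) = ∂̄∂H - ∂̄H H⁻¹ ∂H`. -/
theorem mul_matDbar_inv_mul_matD (hH : ∀ a c, ContDiffAt ℝ 2 (fun w => H w a c) z)
    (hu : IsUnit (H z).det) :
    H z * matDbar b (fun w => (H w)⁻¹ * matD b H w) z
      = matDbar b (matD b H) z - matDbar b H z * ((H z)⁻¹ * matD b H z) := by
  have hd : ∀ a c, DifferentiableAt ℝ (fun w => H w a c) z :=
    fun a c => (hH a c).differentiableAt (by norm_num)
  -- Leibniz rule for the product `H (H⁻¹ ∂H)`, which equals `∂H` near `z`.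
  have h1 := matDbar_mul (b := b) hd
    (differentiableAt_inv_mul_matD (b := b) hH hu)
  have h2 : (fun w => H w * ((H w)⁻¹ * matD b H w)) =ᶠ[nhds z] matD b H := by
    filter_upwards [eventually_isUnit_det hd hu] with w hw
    rw [Matrix.mul_nonsing_inv_cancel_left _ _ hw]
  rw [matDbar_congr h2] at h1
  rw [h1]
  abel

/-- The `∂∂̄`-derivative of the square length of a holomorphic section, in terms of the
derivatives of the metric. -/
theorem dirDbar_dirD_quadratic (hH : ∀ a c, ContDiffAt ℝ 2 (fun w => H w a c) z)
    (v : Fin r → ℂ) (ℓ : Fin r → CSpace n →L[ℂ] ℂ) :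
    dirDbar b (dirD b fun w => (star fun a => v a + ℓ a (w - z)) ⬝ᵥ
        (H w *ᵥ fun a => v a + ℓ a (w - z))) z
      = star (fun a => ℓ a b) ⬝ᵥ (matD b H z *ᵥ v)
        + star (fun a => ℓ a b) ⬝ᵥ (H z *ᵥ fun a => ℓ a b)
        + (star v ⬝ᵥ (matDbar b (matD b H) z *ᵥ v)
        + star v ⬝ᵥ (matDbar b H z *ᵥ fun a => ℓ a b)) := by
  have haff : ∀ a (w : CSpace n), DifferentiableAt ℝ (fun w => v a + ℓ a (w - z)) w :=
    fun a w => (differentiable_affine (ℓ a) (v a) z) w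
  have hstar : ∀ a (w : CSpace n), DifferentiableAt ℝ (fun w => star (v a + ℓ a (w - z))) w :=
    fun a w => (haff a w).star
  have hd : ∀ a c, DifferentiableAt ℝ (fun w => H w a c) z :=
    fun a c => (hH a c).differentiableAt (by norm_num)
  have hev : ∀ᶠ w in nhds z, ∀ a c, DifferentiableAt ℝ (fun w => H w a c) w :=
    Filter.eventually_all.2 fun a => Filter.eventually_all.2 fun c =>
      (hH a c).eventually_differentiableAt
  have hq : (fun w => (star fun a => v a + ℓ a (w - z)) ⬝ᵥ (H w *ᵥ fun a => v a + ℓ a (w - z)))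
      = fun w => ∑ a, ∑ c, star (v a + ℓ a (w - z)) * (H w a c * (v c + ℓ c (w - z))) := by
    funext w
    simp only [dotProduct, mulVec, Pi.star_apply, Finset.mul_sum]
  -- The conjugated coefficients are antiholomorphic, so `∂_b` acts only on `H` and on the
  -- holomorphic factor.
  have h1 : (dirD b fun w => ∑ a, ∑ c, star (v a + ℓ a (w - z)) *
        (H w a c * (v c + ℓ c (w - z)))) =ᶠ[nhds z]
      fun w => ∑ a, ∑ c, star (v a + ℓ a (w - z)) *
        (dirD b (fun w => H w a c) w * (v c + ℓ c (w - z)) + H w a c * ℓ c b) := by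
    filter_upwards [hev] with w hw
    rw [dirD_sum _ _ fun a _ => DifferentiableAt.fun_sum fun c _ =>
      (hstar a w).fun_mul ((hw a c).fun_mul (haff c w))]
    refine Finset.sum_congr rfl fun a _ => ?_
    rw [dirD_sum _ _ fun c _ => (hstar a w).fun_mul ((hw a c).fun_mul (haff c w))]
    refine Finset.sum_congr rfl fun c _ => ?_
    rw [dirD_mul b (hstar a w) ((hw a c).fun_mul (haff c w)), dirD_star b (haff a w),
      dirDbar_affine, dirD_mul b (hw a c) (haff c w), dirD_affine]
    simp
  have hD : ∀ a c, DifferentiableAt ℝ (dirD b fun w => H w a c) z :=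
    fun a c => (hH a c).differentiableAt_dirD b
  have hin : ∀ a c, DifferentiableAt ℝ (fun w => dirD b (fun w => H w a c) w *
      (v c + ℓ c (w - z)) + H w a c * ℓ c b) z := fun a c =>
    ((hD a c).mul (haff c z)).add ((hd a c).mul_const _)
  have hadd : ∀ {p q : CSpace n → ℂ}, DifferentiableAt ℝ p z → DifferentiableAt ℝ q z →
      dirDbar b (fun w => p w + q w) z = dirDbar b p z + dirDbar b q z := fun hp hq => by
    simp only [dirDbar, fderiv_fun_add hp hq, _root_.add_apply]
    ring
  have hmulc : ∀ {p : CSpace n → ℂ} (k : ℂ), DifferentiableAt ℝ p z →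
      dirDbar b (fun w => p w * k) z = dirDbar b p z * k := fun k hp => by
    simp only [mul_comm _ k, dirDbar_const_mul b k hp]
  rw [hq, dirDbar_congr h1, dirDbar_sum _ _ fun a _ => DifferentiableAt.fun_sum fun c _ =>
      (hstar a z).fun_mul (hin a c)]
  simp only [dotProduct, mulVec, Pi.star_apply, Finset.mul_sum, ← Finset.sum_add_distrib]
  refine Finset.sum_congr rfl fun a _ => ?_
  rw [dirDbar_sum _ _ fun c _ => (hstar a z).fun_mul (hin a c)]
  refine Finset.sum_congr rfl fun c _ => ?_
  rw [dirDbar_mul b (hstar a z) (hin a c), dirDbar_star b (haff a z), dirD_affine,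
    hadd ((hD a c).fun_mul (haff c z)) ((hd a c).mul_const _), hmulc _ (hd a c),
    dirDbar_mul b (hD a c) (haff c z), dirDbar_affine]
  simp [matD, matDbar]
  ring

/-- For a Hermitian metric `H` and a holomorphic section with value `v` at `z`, the
`∂∂̄`-derivative of the square length is the curvature term plus the square length of the covariant
derivative of the section. -/
theorem dirDbar_dirD_eq_curvature_add (hH : ∀ a c, ContDiffAt ℝ 2 (fun w => H w a c) z)
    (hherm : ∀ᶠ w in nhds z, (H w).IsHermitian) (hu : IsUnit (H z).det)
    (v : Fin r → ℂ) (ℓ : Fin r → CSpace n →L[ℂ] ℂ) :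
    dirDbar b (dirD b fun w => (star fun a => v a + ℓ a (w - z)) ⬝ᵥ
        (H w *ᵥ fun a => v a + ℓ a (w - z))) z
      = star v ⬝ᵥ ((H z * matDbar b (fun w => (H w)⁻¹ * matD b H w) z) *ᵥ v)
        + star ((fun a => ℓ a b) + ((H z)⁻¹ * matD b H z) *ᵥ v) ⬝ᵥ
          (H z *ᵥ ((fun a => ℓ a b) + ((H z)⁻¹ * matD b H z) *ᵥ v)) := by
  have hd : ∀ a c, DifferentiableAt ℝ (fun w => H w a c) z :=
    fun a c => (hH a c).differentiableAt (by norm_num)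
  have hz : (H z)ᴴ = H z := hherm.self_of_nhds
  rw [dirDbar_dirD_quadratic hH, mul_matDbar_inv_mul_matD hH hu,
    matDbar_eq_conjTranspose hd hherm]
  set D := matD b H z
  set u : Fin r → ℂ := fun a => ℓ a b
  -- Completing the square: in the square length of `u + H⁻¹ D v`, the term `v* Dᴴ H⁻¹ D v` is
  -- exactly what the curvature term subtracts from `v* (∂̄∂H) v`.
  have h1 : H z *ᵥ (((H z)⁻¹ * D) *ᵥ v) = D *ᵥ v := by
    rw [Matrix.mulVec_mulVec, Matrix.mul_nonsing_inv_cancel_left _ _ hu]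
  have h2 : ∀ x, star (((H z)⁻¹ * D) *ᵥ v) ⬝ᵥ x = star v ⬝ᵥ ((Dᴴ * (H z)⁻¹) *ᵥ x) := fun x => by
    rw [Matrix.star_mulVec, Matrix.conjTranspose_mul, Matrix.conjTranspose_nonsing_inv, hz,
      Matrix.dotProduct_mulVec]
  rw [Matrix.mulVec_add, h1, star_add, add_dotProduct, h2, dotProduct_add, Matrix.mulVec_add,
    dotProduct_add, Matrix.mulVec_mulVec, Matrix.mulVec_mulVec, Matrix.sub_mulVec,
    dotProduct_sub, Matrix.mul_assoc Dᴴ, Matrix.nonsing_inv_mul _ hu, Matrix.mul_one,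
    Matrix.mul_assoc Dᴴ]
  ring

end MatrixCalculus

/-! ### Comparison of curvatures at a touching point -/

section Touching

open scoped ComplexOrder

variable {n r : ℕ} {G H : CSpace n → Matrix (Fin r) (Fin r) ℂ} {z : CSpace n}

/-- If the metric `G` touches the metric `μ H` from below at the vector `v` over `z`, then the
curvature terms of `G` and `μ H` compare at `v`. -/
theorem curvature_le_of_touching (hG : ∀ a c, ContDiffAt ℝ 2 (fun w => G w a c) z)
    (hH : ∀ a c, ContDiffAt ℝ 2 (fun w => H w a c) z)
    (hGp : ∀ᶠ w in nhds z, (G w).PosDef) (hHp : ∀ᶠ w in nhds z, (H w).PosDef)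
    {μ : ℝ} {v : Fin r → ℂ}
    (hle : ∀ᶠ w in nhds z, ∀ x : Fin r → ℂ,
      (star x ⬝ᵥ (G w *ᵥ x)).re ≤ μ * (star x ⬝ᵥ (H w *ᵥ x)).re)
    (heq : (star v ⬝ᵥ (G z *ᵥ v)).re = μ * (star v ⬝ᵥ (H z *ᵥ v)).re) (b : CSpace n) :
    (star v ⬝ᵥ ((G z * matDbar b (fun w => (G w)⁻¹ * matD b G w) z) *ᵥ v)).re
      ≤ μ * (star v ⬝ᵥ ((H z * matDbar b (fun w => (H w)⁻¹ * matD b H w) z) *ᵥ v)).re := by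
  have hGu : IsUnit (G z).det :=
    (Matrix.isUnit_iff_isUnit_det _).1 hGp.self_of_nhds.isUnit
  have hHu : IsUnit (H z).det :=
    (Matrix.isUnit_iff_isUnit_det _).1 hHp.self_of_nhds.isUnit
  -- The slope is minus the connection form of `H` applied to `v`, so the section `v + ℓ (w - z)`
  -- has vanishing `H`-covariant derivative at `z`.
  let ℓ : Fin r → CSpace n →L[ℂ] ℂ := fun a =>
    ∑ j, (-(((H z)⁻¹ * matD (stdVec j) H z) *ᵥ v) a) • (EuclideanSpace.proj j : CSpace n →L[ℂ] ℂ)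
  have hD : matD b H z = ∑ j, b j • matD (stdVec j) H z := by
    ext a c
    simp only [matD, Matrix.of_apply, dirD_eq_sum, Matrix.sum_apply, Matrix.smul_apply]
    exact Finset.sum_congr rfl fun j _ => by rw [smul_eq_mul, ← dirD_eq_sum]; rfl
  have hℓ : (fun a => ℓ a b) + ((H z)⁻¹ * matD b H z) *ᵥ v = 0 := by
    funext a
    rw [hD, Matrix.mul_sum, Matrix.sum_mulVec]
    simp only [ℓ, Pi.add_apply, _root_.sum_apply, _root_.smul_apply, Finset.sum_apply,
      Pi.zero_apply, ← Finset.sum_add_distrib]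
    refine Finset.sum_eq_zero fun j _ => ?_
    rw [Matrix.mul_smul, Matrix.smul_mulVec]
    simp
    ring
  have h1 := dirDbar_dirD_eq_curvature_add (b := b) hG (hGp.mono fun _ h => h.isHermitian) hGu v ℓ
  have h2 := dirDbar_dirD_eq_curvature_add (b := b) hH (hHp.mono fun _ h => h.isHermitian) hHu v ℓ
  rw [hℓ] at h2
  -- The `G`-covariant derivative of this section need not vanish, but its square length has the
  -- favourable sign.
  have hpos : 0 ≤ (star ((fun a => ℓ a b) + ((G z)⁻¹ * matD b G z) *ᵥ v) ⬝ᵥ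
      (G z *ᵥ ((fun a => ℓ a b) + ((G z)⁻¹ * matD b G z) *ᵥ v))).re :=
    (Complex.le_def.1 (hGp.self_of_nhds.posSemidef.dotProduct_mulVec_nonneg _)).1
  have hsm : ∀ {P : CSpace n → Matrix (Fin r) (Fin r) ℂ},
      (∀ a c, ContDiffAt ℝ 2 (fun w => P w a c) z) → ContDiffAt ℝ 2
        (fun w => (star fun a => v a + ℓ a (w - z)) ⬝ᵥ (P w *ᵥ fun a => v a + ℓ a (w - z))) z := by
    intro P hP
    have haff : ∀ a, ContDiffAt ℝ 2 (fun w => v a + ℓ a (w - z)) z := fun a =>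
      contDiffAt_const.add
        (((ℓ a).restrictScalars ℝ).contDiff.contDiffAt.comp z (contDiffAt_id.sub contDiffAt_const))
    simp only [dotProduct, mulVec, Pi.star_apply]
    refine ContDiffAt.sum fun a _ => ContDiffAt.mul ?_ (ContDiffAt.sum fun c _ =>
      (hP a c).mul (haff c))
    exact (Complex.conjCLE : ℂ →L[ℝ] ℂ).contDiff.contDiffAt.comp z (haff a)
  have hGs := hsm hG
  have hHs := hsm hH
  set fG := fun w => (star fun a => v a + ℓ a (w - z)) ⬝ᵥ (G w *ᵥ fun a => v a + ℓ a (w - z))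
    with hfG
  set fH := fun w => (star fun a => v a + ℓ a (w - z)) ⬝ᵥ (H w *ᵥ fun a => v a + ℓ a (w - z))
    with hfH
  have hmin : IsLocalMin (fun w => ((μ : ℂ) * fH w - fG w).re) z := by
    have h0 : ((μ : ℂ) * fH z - fG z).re = 0 := by
      simp [hfG, hfH, heq]
    filter_upwards [hle] with w hw
    rw [h0, Complex.sub_re, Complex.re_ofReal_mul]
    exact sub_nonneg.2 (hw _)
  have hcomb := re_dirDbar_dirD_nonneg ((contDiffAt_const.mul hHs).sub hGs) hmin b
  have hdd : dirDbar b (dirD b fun w => (μ : ℂ) * fH w - fG w) z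
      = μ * dirDbar b (dirD b fH) z - dirDbar b (dirD b fG) z := by
    have h3 : (dirD b fun w => (μ : ℂ) * fH w - fG w) =ᶠ[nhds z]
        fun w => μ * dirD b fH w - dirD b fG w := by
      filter_upwards [hHs.eventually_differentiableAt, hGs.eventually_differentiableAt]
        with w hw1 hw2
      rw [dirD_sub b (hw1.const_mul _) hw2, dirD_const_mul b _ hw1]
    rw [dirDbar_congr h3, dirDbar_sub b ((hHs.differentiableAt_dirD b).const_mul _)
      (hGs.differentiableAt_dirD b), dirDbar_const_mul b _ (hHs.differentiableAt_dirD b)]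
  have hcomb' : 0 ≤ (μ * dirDbar b (dirD b fH) z - dirDbar b (dirD b fG) z).re := by
    rw [← hdd]; exact hcomb
  rw [h1, h2, Complex.sub_re, Complex.re_ofReal_mul] at hcomb'
  simp only [Matrix.mulVec_zero, dotProduct_zero, add_zero, Complex.add_re] at hcomb'
  linarith

end Touching

/-! ## Positive `(1,1)`-forms -/

section PositiveForms

open scoped ComplexOrder

variable {n : ℕ}

/-- Twice the Hermitian form associated with a real `2`-form of type `(1,1)`. -/
noncomputable def hermitianPairing (α : CSpace n [⋀^Fin 2]→L[ℝ] ℝ) (u v : CSpace n) : ℂ :=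
  ((α ![u, Complex.I • v] : ℝ) : ℂ) - Complex.I * ((α ![u, v] : ℝ) : ℂ)

variable {α : CSpace n [⋀^Fin 2]→L[ℝ] ℝ}

theorem alternating_pair_swap (u v : CSpace n) : α ![u, v] = -α ![v, u] := by
  have h := α.toAlternatingMap.map_swap ![v, u] (show (0 : Fin 2) ≠ 1 by decide)
  have h2 : ![v, u] ∘ Equiv.swap (0 : Fin 2) 1 = ![u, v] := by
    funext i; fin_cases i <;> rfl
  rw [h2] at h
  exact h

theorem I_smul_I_smul (u : CSpace n) : Complex.I • Complex.I • u = -u := by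
  rw [smul_smul, Complex.I_mul_I, neg_one_smul]

theorem alternating_pair_neg_right (u v : CSpace n) : α ![u, -v] = -α ![u, v] := by
  rw [alternating_pair_swap u (-v), alternating_pair_swap u v]
  have := α.vecCons_smul ![u] (-1 : ℝ) v
  rw [neg_one_smul, neg_one_smul] at this
  rw [this]

theorem hermitianPairing_add_left (u u' v : CSpace n) :
    hermitianPairing α (u + u') v = hermitianPairing α u v + hermitianPairing α u' v := by
  unfold hermitianPairing
  rw [α.vecCons_add, α.vecCons_add]
  push_cast
  ring

theorem pair_I_smul_left (h11 : ∀ u v, α ![Complex.I • u, Complex.I • v] = α ![u, v])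
    (u v : CSpace n) : α ![Complex.I • u, v] = -α ![u, Complex.I • v] := by
  rw [← h11 u, I_smul_I_smul, alternating_pair_neg_right, neg_neg]

theorem hermitianPairing_smul_left (h11 : ∀ u v, α ![Complex.I • u, Complex.I • v] = α ![u, v])
    (c : ℂ) (u v : CSpace n) : hermitianPairing α (c • u) v = c * hermitianPairing α u v := by
  have hr : ∀ (x : ℝ) (u : CSpace n),
      hermitianPairing α (x • u) v = x * hermitianPairing α u v := fun x u => by
    unfold hermitianPairing
    rw [α.vecCons_smul, α.vecCons_smul]
    simp
    ring
  have hI : hermitianPairing α (Complex.I • u) v = Complex.I * hermitianPairing α u v := by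
    unfold hermitianPairing
    rw [h11, pair_I_smul_left h11]
    push_cast
    linear_combination ((α ![u, v] : ℝ) : ℂ) * Complex.I_mul_I
  have h : c • u = c.re • u + c.im • (Complex.I • u) := by
    conv_lhs => rw [← Complex.re_add_im c]
    rw [add_smul, mul_smul]
    rfl
  rw [h, hermitianPairing_add_left, hr, hr, hI]
  conv_rhs => rw [← Complex.re_add_im c]
  ring

theorem star_hermitianPairing (h11 : ∀ u v, α ![Complex.I • u, Complex.I • v] = α ![u, v])
    (u v : CSpace n) : star (hermitianPairing α u v) = hermitianPairing α v u := by
  unfold hermitianPairing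
  rw [alternating_pair_swap v (Complex.I • u), pair_I_smul_left h11, alternating_pair_swap v u]
  simp

theorem hermitianPairing_sum_left (h11 : ∀ u v, α ![Complex.I • u, Complex.I • v] = α ![u, v])
    {ι : Type*} (s : Finset ι) (c : ι → ℂ) (u : ι → CSpace n) (v : CSpace n) :
    hermitianPairing α (∑ i ∈ s, c i • u i) v = ∑ i ∈ s, c i * hermitianPairing α (u i) v := by
  classical
  induction s using Finset.induction_on with
  | empty => simpa using hermitianPairing_smul_left h11 0 0 v
  | insert i s hi ih =>
    rw [Finset.sum_insert hi, Finset.sum_insert hi, hermitianPairing_add_left, ih,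
      hermitianPairing_smul_left h11]

/-- For type `(1,1)` the four terms of `coeff11` coincide in pairs. This isolates the factor `i` in
front of a Hermitian matrix. -/
theorem coeff11_eq_I_smul (h11 : ∀ u v, α ![Complex.I • u, Complex.I • v] = α ![u, v]) :
    coeff11 α = Complex.I •
      Matrix.of fun j k => hermitianPairing α (stdVec j) (stdVec k) / 2 := by
  ext j k
  simp only [coeff11, Matrix.of_apply, Matrix.smul_apply, smul_eq_mul, hermitianPairing, h11,
    pair_I_smul_left h11]
  push_cast
  linear_combination (((α ![stdVec j, stdVec k] : ℝ) : ℂ) / 2) * Complex.I_mul_I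

theorem hermitianPairing_matrix_posDef
    (h11 : ∀ u v, α ![Complex.I • u, Complex.I • v] = α ![u, v])
    (hpos : ∀ u, u ≠ 0 → 0 < α ![u, Complex.I • u]) :
    (Matrix.of fun j k => hermitianPairing α (stdVec j) (stdVec k) / 2 :
      Matrix (Fin n) (Fin n) ℂ).PosDef := by
  refine Matrix.PosDef.of_dotProduct_mulVec_pos ?_ fun c hc => ?_
  · ext j k
    rw [Matrix.conjTranspose_apply, Matrix.of_apply, Matrix.of_apply, star_div₀,
      star_hermitianPairing h11]
    simp
  -- The coefficients are conjugated because the pairing is linear in its first variable, whereas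
  -- `c* P c` conjugates the row index.
  · set u : CSpace n := ∑ j, star (c j) • stdVec j with hu
    have hu0 : u ≠ 0 := fun h0 => hc <| by
      funext j
      have h1 : u = WithLp.toLp 2 (star c) := sum_smul_stdVec (WithLp.toLp 2 (star c))
      have h2 := congrArg (fun w : CSpace n => w j) (h1.symm.trans h0)
      simpa using h2
    have hsum : star c ⬝ᵥ ((Matrix.of fun j k => hermitianPairing α (stdVec j) (stdVec k) / 2 :
        Matrix (Fin n) (Fin n) ℂ) *ᵥ c) = hermitianPairing α u u / 2 := by
      have h1 : ∀ j, hermitianPairing α (stdVec j) u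
          = ∑ k, c k * hermitianPairing α (stdVec j) (stdVec k) := fun j => by
        rw [← star_hermitianPairing h11, hu, hermitianPairing_sum_left h11, star_sum]
        refine Finset.sum_congr rfl fun k _ => ?_
        rw [star_mul', star_star, star_hermitianPairing h11]
      conv_rhs => rw [hu, hermitianPairing_sum_left h11, ← hu]
      simp only [dotProduct, mulVec, Pi.star_apply, Matrix.of_apply, h1, Finset.sum_div,
        Finset.mul_sum]
      exact Finset.sum_congr rfl fun j _ => Finset.sum_congr rfl fun k _ => by ring
    have h0 : α ![u, u] = 0 := by
      have := alternating_pair_swap (α := α) u u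
      linarith
    have hval : hermitianPairing α u u / 2 = ((α ![u, Complex.I • u] / 2 : ℝ) : ℂ) := by
      simp [hermitianPairing, h0]
    rw [hsum, hval]
    exact_mod_cast half_pos (hpos u hu0)

/-- The inverse of the coefficient matrix of a positive `(1,1)`-form is, up to `-i`, a sum of
squares. -/
theorem coeff11_inv_eq_sum (h11 : ∀ u v, α ![Complex.I • u, Complex.I • v] = α ![u, v])
    (hpos : ∀ u, u ≠ 0 → 0 < α ![u, Complex.I • u]) :
    ∃ (m : ℕ) (b : Fin m → CSpace n),
      ∀ j k, (coeff11 α)⁻¹ k j = -Complex.I * ∑ l, star (b l k) * b l j := by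
  have hP := hermitianPairing_matrix_posDef h11 hpos
  -- The inverse of a positive definite matrix is a sum of rank-one matrices `v v*`; the directions
  -- `b` are the conjugates of the vectors `v`.
  obtain ⟨m, v, hv⟩ := Matrix.posSemidef_iff_eq_sum_vecMulVec.1 hP.inv.posSemidef
  refine ⟨m, fun l => WithLp.toLp 2 (star (v l)), fun j k => ?_⟩
  have hu := (Matrix.isUnit_iff_isUnit_det _).1 hP.isUnit
  have hinv : (coeff11 α)⁻¹ = (-Complex.I) •
      (Matrix.of fun j k => hermitianPairing α (stdVec j) (stdVec k) / 2 :
        Matrix (Fin n) (Fin n) ℂ)⁻¹ := by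
    apply Matrix.inv_eq_right_inv
    rw [coeff11_eq_I_smul h11, Matrix.smul_mul, Matrix.mul_smul, smul_smul,
      Matrix.mul_nonsing_inv _ hu]
    simp
  rw [hinv, hv]
  simp [Matrix.sum_apply, Matrix.vecMulVec_apply]

end PositiveForms

/-- The differential of a holomorphic chart inverse is complex linear and injective, so type `(1,1)`
and positivity survive in coordinates. -/
theorem KahlerForm.exists_contraction_directions {n : ℕ} {X : Type*} [TopologicalSpace X]
    [ChartedSpace (CSpace n) X] [IsManifold 𝓘(ℂ, CSpace n) ω X] (κ : KahlerForm n X)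
    {φ : OpenPartialHomeomorph X (CSpace n)} (hφ : φ ∈ atlas (CSpace n) X) {z : CSpace n}
    (hz : z ∈ φ.target) :
    ∃ (m : ℕ) (b : Fin m → CSpace n), ∀ j k, (coeff11 (chartForm κ.form φ z))⁻¹ k j
      = -Complex.I * ∑ l, star (b l k) * b l j := by
  have : IsManifold 𝓘(ℂ, CSpace n) 1 X := IsManifold.of_le (n := ω) le_top
  have hmd : φ.MDifferentiable 𝓘(ℂ, CSpace n) 𝓘(ℂ, CSpace n) := mdifferentiable_of_mem_atlas hφ
  set T := mfderiv 𝓘(ℂ, CSpace n) 𝓘(ℂ, CSpace n) φ.symm z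
  have hinj : Function.Injective T := hmd.symm.mfderiv_injective hz
  have hval : ∀ u v : CSpace n,
      chartForm κ.form φ z ![u, v] = κ.form (φ.symm z) ![T u, T v] := fun u v => by
    change κ.form (φ.symm z) (fun i => T (![u, v] i)) = _
    congr 1
    funext i
    fin_cases i <;> rfl
  have hI : ∀ u : CSpace n, T (Complex.I • u) = Complex.I • T u := fun u => T.map_smul Complex.I u
  refine coeff11_inv_eq_sum (fun u v => ?_) fun u hu => ?_
  · rw [hval, hval]
    have h := κ.type11 (φ.symm z) (T u) (T v)
    rw [hI, hI]
    exact h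
  · rw [hval]
    have h := κ.pos (φ.symm z) (T u) fun h0 => hu (hinj (h0.trans (map_zero T).symm))
    rw [hI]
    exact h

/-! ## The flow equation in local frames -/

section FlowEquation

variable {n r : ℕ} {H : CSpace n → Matrix (Fin r) (Fin r) ℂ} {z : CSpace n}

theorem matDbar_inv_mul_matD_eq_sum (hH : ∀ a c, ContDiffAt ℝ 2 (fun w => H w a c) z)
    (hu : IsUnit (H z).det) (b : CSpace n) :
    matDbar b (fun w => (H w)⁻¹ * matD b H w) z
      = ∑ k, ∑ j, (star (b k) * b j) • matWirtingerBar k (connCoeff H j) z := by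
  ext a c
  have h1 : (fun w => ((H w)⁻¹ * matD b H w) a c) = fun w => ∑ j, b j * connCoeff H j w a c := by
    funext w
    simp only [connCoeff, Matrix.mul_apply, matD, Matrix.of_apply, dirD_eq_sum, matWirtinger,
      Finset.mul_sum]
    rw [Finset.sum_comm]
    exact Finset.sum_congr rfl fun j _ => Finset.sum_congr rfl fun i _ => by ring
  have hd : ∀ j, DifferentiableAt ℝ (fun w => connCoeff H j w a c) z := fun j =>
    differentiableAt_inv_mul_matD (b := stdVec j) hH hu a c
  simp only [matDbar, Matrix.of_apply, Matrix.sum_apply, Matrix.smul_apply, matWirtingerBar, h1,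
    smul_eq_mul]
  rw [dirDbar_eq_sum]
  refine Finset.sum_congr rfl fun k _ => ?_
  have h2 : wirtingerBar k (fun w => ∑ j, b j * connCoeff H j w a c) z
      = ∑ j, b j * wirtingerBar k (fun w => connCoeff H j w a c) z := by
    change dirDbar (stdVec k) _ z = _
    rw [dirDbar_sum _ _ fun j _ => (hd j).const_mul _]
    exact Finset.sum_congr rfl fun j _ => dirDbar_const_mul _ _ (hd j)
  rw [h2, Finset.mul_sum]
  exact Finset.sum_congr rfl fun j _ => by ring

/-- The factor `-i` from `W⁻¹`, the sign in `curvCoeff` and the `-2i` of the flow combine to `+2`.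
This positive sign makes the equation parabolic forward in time. -/
theorem flow_derivative_eq (hH : ∀ a c, ContDiffAt ℝ 2 (fun w => H w a c) z)
    (hu : IsUnit (H z).det) {W : Matrix (Fin n) (Fin n) ℂ} {m : ℕ} {b : Fin m → CSpace n}
    (hW : ∀ j k, W⁻¹ k j = -Complex.I * ∑ l, star (b l k) * b l j) {lam : ℂ}
    {P : Matrix (Fin r) (Fin r) ℂ}
    (hP : (H z)⁻¹ * P = (-2 * Complex.I) •
      (contraction W (curvCoeff H z) - lam • (1 : Matrix (Fin r) (Fin r) ℂ))) :
    P = ∑ l, (2 : ℂ) • (H z * matDbar (b l) (fun w => (H w)⁻¹ * matD (b l) H w) z)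
      + (2 * Complex.I * lam) • H z := by
  have h1 : contraction W (curvCoeff H z)
      = Complex.I • ∑ l, matDbar (b l) (fun w => (H w)⁻¹ * matD (b l) H w) z := by
    simp only [matDbar_inv_mul_matD_eq_sum hH hu, contraction, curvCoeff, hW]
    rw [Finset.sum_comm, Finset.sum_comm (s := (Finset.univ : Finset (Fin m))), Finset.smul_sum]
    refine Finset.sum_congr rfl fun k _ => ?_
    rw [Finset.sum_comm (s := (Finset.univ : Finset (Fin m))), Finset.smul_sum]
    refine Finset.sum_congr rfl fun j _ => ?_
    rw [← Finset.sum_smul, smul_smul, smul_neg, neg_mul, neg_smul, neg_neg]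
  have h2 : P = H z * ((H z)⁻¹ * P) := by rw [Matrix.mul_nonsing_inv_cancel_left _ _ hu]
  rw [h2, hP, h1, smul_sub, smul_smul, smul_smul]
  have h3 : -2 * Complex.I * Complex.I = 2 := by
    rw [mul_assoc, Complex.I_mul_I]; norm_num
  rw [h3, Matrix.mul_sub, Matrix.mul_smul, Matrix.mul_smul, Matrix.mul_one, Matrix.mul_sum,
    Finset.smul_sum, sub_eq_add_neg, ← neg_smul]
  congr 2
  ring

end FlowEquation

/-! ## Hermitian metrics in local frames -/

theorem localMatrix_quadratic {n r : ℕ} {X : Type*} [TopologicalSpace X] {E : X → Type*}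
    [TopologicalSpace (TotalSpace (CSpace r) E)] [∀ x, AddCommGroup (E x)] [∀ x, Module ℂ (E x)]
    (F : ∀ x, E x →ₗ[ℂ] E x →ₛₗ[starRingEnd ℂ] ℂ)
    (φ : OpenPartialHomeomorph X (CSpace n))
    (e : Trivialization (CSpace r) (π (CSpace r) E)) (z : CSpace n) (c : Fin r → ℂ) :
    star c ⬝ᵥ (localMatrix F φ e z *ᵥ c)
      = F (φ.symm z) (∑ a, c a • localFrame e a (φ.symm z))
        (∑ a, c a • localFrame e a (φ.symm z)) := by
  simp only [dotProduct, mulVec, localMatrix, Matrix.of_apply, Pi.star_apply, map_sum,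
    LinearMap.sum_apply, map_smulₛₗ, LinearMap.smul_apply, Finset.mul_sum, smul_eq_mul,
    RingHom.id_apply, starRingEnd_apply]
  exact Finset.sum_congr rfl fun a _ => Finset.sum_congr rfl fun b _ => by ring

section Frames

open scoped ComplexOrder

variable {n r : ℕ} {X : Type*} [TopologicalSpace X] [ChartedSpace (CSpace n) X]
  {E : X → Type*} [TopologicalSpace (TotalSpace (CSpace r) E)] [∀ x, TopologicalSpace (E x)]
  [∀ x, AddCommGroup (E x)] [∀ x, Module ℂ (E x)] [FiberBundle (CSpace r) E]

variable [VectorBundle ℂ (CSpace r) E]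

theorem sum_smul_localFrame (e : Trivialization (CSpace r) (π (CSpace r) E))
    [MemTrivializationAtlas e] {x : X} (hx : x ∈ e.baseSet) (c : Fin r → ℂ) :
    ∑ a, c a • localFrame e a x = (e.linearEquivAt ℂ x hx).symm (WithLp.toLp 2 c) := by
  conv_rhs => rw [← sum_smul_stdVec (WithLp.toLp 2 c)]
  simp [localFrame]

theorem exists_eq_sum_smul_localFrame (e : Trivialization (CSpace r) (π (CSpace r) E))
    [MemTrivializationAtlas e] {x : X} (hx : x ∈ e.baseSet) (v : E x) :
    ∃ c : Fin r → ℂ, v = ∑ a, c a • localFrame e a x :=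
  ⟨(e.linearEquivAt ℂ x hx v).ofLp, by
    rw [sum_smul_localFrame e hx]
    exact ((e.linearEquivAt ℂ x hx).symm_apply_apply v).symm⟩

theorem sum_smul_localFrame_ne_zero (e : Trivialization (CSpace r) (π (CSpace r) E))
    [MemTrivializationAtlas e] {x : X} (hx : x ∈ e.baseSet) {c : Fin r → ℂ} (hc : c ≠ 0) :
    ∑ a, c a • localFrame e a x ≠ 0 := by
  rw [sum_smul_localFrame e hx, Ne, LinearEquiv.map_eq_zero_iff]
  simpa using hc

theorem HermitianMetric.localMatrix_posDef (h : HermitianMetric n r E)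
    (φ : OpenPartialHomeomorph X (CSpace n)) (e : Trivialization (CSpace r) (π (CSpace r) E))
    [MemTrivializationAtlas e] {z : CSpace n} (hz : z ∈ localDomain φ e) :
    (localMatrix h.form φ e z).PosDef := by
  refine Matrix.PosDef.of_dotProduct_mulVec_pos ?_ fun c hc => ?_
  · ext a b
    exact (h.symm _ _ _).symm
  · rw [localMatrix_quadratic, Complex.lt_def]
    refine ⟨h.pos _ _ (sum_smul_localFrame_ne_zero e hz.2 hc), ?_⟩
    have := congrArg Complex.im (h.symm (φ.symm z) (∑ a, c a • localFrame e a (φ.symm z))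
      (∑ a, c a • localFrame e a (φ.symm z)))
    rw [Complex.star_def, Complex.conj_im] at this
    rw [Complex.zero_im]
    linarith

end Frames

theorem isOpen_localDomain {n r : ℕ} {X : Type*} [TopologicalSpace X] [ChartedSpace (CSpace n) X]
    {E : X → Type*} [TopologicalSpace (TotalSpace (CSpace r) E)]
    (φ : OpenPartialHomeomorph X (CSpace n))
    (e : Trivialization (CSpace r) (π (CSpace r) E)) : IsOpen (localDomain φ e) :=
  φ.continuousOn_symm.isOpen_inter_preimage φ.open_target e.open_baseSet

/-! ## The maximum principle -/

/-- The difference quotients from the left are nonnegative. -/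
theorem HasDerivAt.nonneg_of_forall_lt_le {p : ℝ → ℝ} {p' t₀ : ℝ} (hp : HasDerivAt p p' t₀)
    (ht₀ : 0 < t₀) (hle : ∀ t, 0 ≤ t → t < t₀ → p t ≤ p t₀) : 0 ≤ p' := by
  have h1 := (hasDerivWithinAt_iff_tendsto_slope' (s := Iio t₀) (by simp)).1
    hp.hasDerivWithinAt
  refine ge_of_tendsto h1 ?_
  filter_upwards [self_mem_nhdsWithin, mem_nhdsWithin_of_mem_nhds (Ioi_mem_nhds ht₀)]
    with t ht1 ht2
  rw [slope_def_field]
  exact div_nonneg_of_nonpos (sub_nonpos.2 (hle t (le_of_lt ht2) ht1))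
    (sub_nonpos.2 (le_of_lt ht1))

section MaximumPrinciple

open scoped ComplexOrder

variable {n r : ℕ} {X : Type*} [TopologicalSpace X] [ChartedSpace (CSpace n) X]
  {E : X → Type*} [TopologicalSpace (TotalSpace (CSpace r) E)] [∀ x, TopologicalSpace (E x)]
  [∀ x, AddCommGroup (E x)] [∀ x, Module ℂ (E x)] [FiberBundle (CSpace r) E]

namespace IsDonaldsonFlow

variable {κ : KahlerForm n X} {lam : ℂ} {g h : ℝ → HermitianMetric n r E}

theorem contDiffAt_localMatrix (hh : IsDonaldsonFlow κ lam h) {t : ℝ} (ht : 0 ≤ t)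
    {φ : OpenPartialHomeomorph X (CSpace n)} (hφ : φ ∈ atlas (CSpace n) X)
    (e : Trivialization (CSpace r) (π (CSpace r) E)) [MemTrivializationAtlas e]
    {z : CSpace n} (hz : z ∈ localDomain φ e) (a b : Fin r) :
    ContDiffAt ℝ 2 (fun w => localMatrix (h t).form φ e w a b) z := by
  have h1 : ContDiffOn ℝ ∞ (fun w => localMatrix (h t).form φ e w a b) (localDomain φ e) :=
    (hh.smooth φ hφ e a b).comp (contDiffOn_const.prodMk contDiffOn_id) fun w hw => ⟨ht, hw⟩
  exact (h1.contDiffAt ((isOpen_localDomain φ e).mem_nhds hz)).of_le (WithTop.coe_le_coe.2 le_top)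

theorem hasDerivAt_quadratic (hh : IsDonaldsonFlow κ lam h) {t : ℝ} (ht : 0 < t)
    {φ : OpenPartialHomeomorph X (CSpace n)} (hφ : φ ∈ atlas (CSpace n) X)
    (e : Trivialization (CSpace r) (π (CSpace r) E)) [MemTrivializationAtlas e]
    {z : CSpace n} (hz : z ∈ localDomain φ e) (v : Fin r → ℂ) :
    HasDerivAt (fun s => (star v ⬝ᵥ (localMatrix (h s).form φ e z *ᵥ v)).re)
      (star v ⬝ᵥ ((Matrix.of fun a b =>
        derivWithin (fun s => localMatrix (h s).form φ e z a b) (Ici (0 : ℝ)) t) *ᵥ v)).re t := by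
  have h1 : ∀ a b, HasDerivAt (fun s => localMatrix (h s).form φ e z a b)
      (derivWithin (fun s => localMatrix (h s).form φ e z a b) (Ici (0 : ℝ)) t) t := fun a b => by
    have h2 : ContDiffOn ℝ ∞ (fun s => localMatrix (h s).form φ e z a b) (Ici (0 : ℝ)) :=
      (hh.smooth φ hφ e a b).comp (contDiffOn_id.prodMk contDiffOn_const) fun s hs => ⟨hs, hz⟩
    -- At a positive time `[0, ∞)` is a neighbourhood, so the one-sided derivative of the flow is a
    -- genuine derivative.
    exact ((h2.differentiableOn (by simp)) t ht.le).hasDerivWithinAt.hasDerivAt (Ici_mem_nhds ht)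
  have h3 : HasDerivAt (fun s => star v ⬝ᵥ (localMatrix (h s).form φ e z *ᵥ v))
      (star v ⬝ᵥ ((Matrix.of fun a b =>
        derivWithin (fun s => localMatrix (h s).form φ e z a b) (Ici (0 : ℝ)) t) *ᵥ v)) t := by
    simp only [dotProduct, mulVec]
    exact HasDerivAt.fun_sum fun a _ =>
      (HasDerivAt.fun_sum fun b _ => (h1 a b).mul_const _).const_mul _
  exact Complex.reCLM.hasFDerivAt.comp_hasDerivAt t h3

variable [VectorBundle ℂ (CSpace r) E]

/-- At the first time when `g` touches `(1 + ε (1 + t)) h`, the flow equation is violated. -/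
theorem no_first_touching [IsManifold 𝓘(ℂ, CSpace n) ω X]
    (hg : IsDonaldsonFlow κ lam g) (hh : IsDonaldsonFlow κ lam h)
    {ε t₀ : ℝ} (hε : 0 < ε) (ht₀ : 0 < t₀)
    (hle : ∀ t, 0 ≤ t → t ≤ t₀ → ∀ (x : X) (v : E x),
      ((g t).form x v v).re ≤ (1 + ε * (1 + t)) * ((h t).form x v v).re)
    (x : X) (v : E x) (hv : v ≠ 0) :
    ((g t₀).form x v v).re ≠ (1 + ε * (1 + t₀)) * ((h t₀).form x v v).re := by
  intro heq
  obtain ⟨φ, hφ, e, he, z, hzt, hze, rfl⟩ : ∃ φ ∈ atlas (CSpace n) X,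
      ∃ (e : Trivialization (CSpace r) (π (CSpace r) E)) (_ : MemTrivializationAtlas e),
        ∃ z ∈ φ.target, φ.symm z ∈ e.baseSet ∧ φ.symm z = x := by
    have hx := (chartAt (CSpace n) x).left_inv (mem_chart_source _ x)
    exact ⟨chartAt (CSpace n) x, chart_mem_atlas _ _, trivializationAt (CSpace r) E x,
      inferInstance, chartAt (CSpace n) x x, mem_chart_target _ x,
      by rw [hx]; exact mem_baseSet_trivializationAt _ _ x, hx⟩
  have hz : z ∈ localDomain φ e := ⟨hzt, hze⟩
  obtain ⟨c, rfl⟩ := exists_eq_sum_smul_localFrame e hz.2 v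
  have hc : c ≠ 0 := by
    rintro rfl
    simp at hv
  set G := fun t => localMatrix (g t).form φ e
  set H := fun t => localMatrix (h t).form φ e
  have hq : ∀ t, 0 ≤ t → t ≤ t₀ → ∀ w (u : Fin r → ℂ),
      (star u ⬝ᵥ (G t w *ᵥ u)).re ≤ (1 + ε * (1 + t)) * (star u ⬝ᵥ (H t w *ᵥ u)).re := by
    intro t h0 h1 w u
    simp only [G, H, localMatrix_quadratic]
    exact hle t h0 h1 _ _
  have hqe : (star c ⬝ᵥ (G t₀ z *ᵥ c)).re
      = (1 + ε * (1 + t₀)) * (star c ⬝ᵥ (H t₀ z *ᵥ c)).re := by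
    simp only [G, H, localMatrix_quadratic]
    exact heq
  have hnhds := (isOpen_localDomain φ e).mem_nhds hz
  have hGs := hg.contDiffAt_localMatrix ht₀.le hφ e hz
  have hHs := hh.contDiffAt_localMatrix ht₀.le hφ e hz
  have hGp : ∀ᶠ w in nhds z, (G t₀ w).PosDef := by
    filter_upwards [hnhds] with w hw using (g t₀).localMatrix_posDef φ e hw
  have hHp : ∀ᶠ w in nhds z, (H t₀ w).PosDef := by
    filter_upwards [hnhds] with w hw using (h t₀).localMatrix_posDef φ e hw
  have hGu := (Matrix.isUnit_iff_isUnit_det _).1 hGp.self_of_nhds.isUnit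
  have hHu := (Matrix.isUnit_iff_isUnit_det _).1 hHp.self_of_nhds.isUnit
  obtain ⟨m, b, hb⟩ := κ.exists_contraction_directions hφ hzt
  have hGd := hg.hasDerivAt_quadratic ht₀ hφ e hz c
  have hHd := hh.hasDerivAt_quadratic ht₀ hφ e hz c
  rw [flow_derivative_eq hGs hGu hb (hg.equation t₀ ht₀.le φ hφ e z hz)] at hGd
  rw [flow_derivative_eq hHs hHu hb (hh.equation t₀ ht₀.le φ hφ e z hz)] at hHd
  -- The values of a Hermitian form on the diagonal are real, so `λ` enters only through the real
  -- part of `2iλ`.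
  have hexp : ∀ (P : Matrix (Fin r) (Fin r) ℂ) (Q : Fin m → Matrix (Fin r) (Fin r) ℂ),
      P.PosDef →
      (star c ⬝ᵥ ((∑ l, (2 : ℂ) • Q l + (2 * Complex.I * lam) • P) *ᵥ c)).re
        = 2 * ∑ l, (star c ⬝ᵥ (Q l *ᵥ c)).re
          + (2 * Complex.I * lam).re * (star c ⬝ᵥ (P *ᵥ c)).re := by
    intro P Q hP
    have him : (star c ⬝ᵥ (P *ᵥ c)).im = 0 :=
      (Complex.le_def.1 (hP.posSemidef.dotProduct_mulVec_nonneg c)).2.symm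
    rw [Matrix.add_mulVec, Matrix.sum_mulVec, dotProduct_add, dotProduct_sum, Complex.add_re,
      Complex.re_sum, Finset.mul_sum, Matrix.smul_mulVec, dotProduct_smul, smul_eq_mul,
      Complex.mul_re _ (star c ⬝ᵥ (P *ᵥ c)), him, mul_zero, sub_zero]
    congr 1
    refine Finset.sum_congr rfl fun l _ => ?_
    rw [Matrix.smul_mulVec, dotProduct_smul, smul_eq_mul]
    simp
  rw [hexp _ _ hGp.self_of_nhds] at hGd
  rw [hexp _ _ hHp.self_of_nhds] at hHd
  have hμd : HasDerivAt (fun t : ℝ => 1 + ε * (1 + t)) ε t₀ := by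
    simpa using (((hasDerivAt_id t₀).const_add 1).const_mul ε).const_add 1
  -- The function `g(v, v) - μ h(v, v)` is nonpositive before `t₀` and zero at `t₀`.
  have hp := (hGd.sub (hμd.mul hHd)).nonneg_of_forall_lt_le ht₀ fun t h0 h1 => by
    have h2 := hq t h0 h1.le z c
    simp only [Pi.sub_apply, Pi.mul_apply]
    simp only [G, H] at h2 hqe
    linarith
  have hcurv := Finset.sum_le_sum fun l (_ : l ∈ (Finset.univ : Finset (Fin m))) =>
    curvature_le_of_touching hGs hHs hGp hHp (Filter.Eventually.of_forall (hq t₀ ht₀.le le_rfl))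
      hqe (b l)
  rw [← Finset.mul_sum] at hcurv
  have hpos : 0 < (star c ⬝ᵥ (H t₀ z *ᵥ c)).re :=
    (Complex.lt_def.1 (hHp.self_of_nhds.dotProduct_mulVec_pos hc)).1
  have hstrict := mul_pos hε hpos
  simp only [G, H] at hcurv hpos hstrict hqe hp
  -- After this substitution the `λ` terms cancel, and `hcurv` bounds the derivative by `-ε h(v,
  -- v)`.
  rw [hqe] at hp
  linarith

end IsDonaldsonFlow

end MaximumPrinciple

/-! ### Propagation of the strict inequality in time -/

section Comparison

variable {n r : ℕ} {X : Type*} [TopologicalSpace X] [ChartedSpace (CSpace n) X]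
  {E : X → Type*} [TopologicalSpace (TotalSpace (CSpace r) E)] [∀ x, TopologicalSpace (E x)]
  [∀ x, AddCommGroup (E x)] [∀ x, Module ℂ (E x)] [FiberBundle (CSpace r) E]

/-- A quadratic inequality on the unit sphere extends to all nonzero vectors. -/
theorem quadratic_lt_of_sphere {r : ℕ} {A B : Matrix (Fin r) (Fin r) ℂ} {μ : ℝ}
    (hs : ∀ c ∈ Metric.sphere (0 : Fin r → ℂ) 1,
      (star c ⬝ᵥ (A *ᵥ c)).re < μ * (star c ⬝ᵥ (B *ᵥ c)).re) {c : Fin r → ℂ} (hc : c ≠ 0) :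
    (star c ⬝ᵥ (A *ᵥ c)).re < μ * (star c ⬝ᵥ (B *ᵥ c)).re := by
  have hpos : 0 < ‖c‖ := norm_pos_iff.2 hc
  have hmem : ((‖c‖⁻¹ : ℝ) : ℂ) • c ∈ Metric.sphere (0 : Fin r → ℂ) 1 := by
    rw [mem_sphere_zero_iff_norm, norm_smul, Complex.norm_real, norm_inv, norm_norm,
      inv_mul_cancel₀ hpos.ne']
  have hscale : ∀ P : Matrix (Fin r) (Fin r) ℂ,
      (star (((‖c‖⁻¹ : ℝ) : ℂ) • c) ⬝ᵥ (P *ᵥ (((‖c‖⁻¹ : ℝ) : ℂ) • c))).re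
        = (‖c‖⁻¹ * ‖c‖⁻¹) * (star c ⬝ᵥ (P *ᵥ c)).re := fun P => by
    rw [star_smul, Matrix.mulVec_smul, dotProduct_smul, smul_dotProduct, smul_smul,
      Complex.star_def, Complex.conj_ofReal, ← Complex.ofReal_mul, smul_eq_mul,
      Complex.re_ofReal_mul]
  have h1 := hs _ hmem
  rw [hscale, hscale, mul_left_comm] at h1
  exact lt_of_mul_lt_mul_left h1 (by positivity)

namespace IsDonaldsonFlow

variable {κ : KahlerForm n X} {lam : ℂ} {g h : ℝ → HermitianMetric n r E}

/-- Continuity is joint in time, point and coefficient vector, as the compactness argument over the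
unit sphere requires. -/
theorem continuousOn_quadratic (hh : IsDonaldsonFlow κ lam h)
    {φ : OpenPartialHomeomorph X (CSpace n)} (hφ : φ ∈ atlas (CSpace n) X)
    (e : Trivialization (CSpace r) (π (CSpace r) E)) [MemTrivializationAtlas e] :
    ContinuousOn (fun q : (ℝ × CSpace n) × (Fin r → ℂ) =>
      (star q.2 ⬝ᵥ (localMatrix (h q.1.1).form φ e q.1.2 *ᵥ q.2)).re)
      ((Ici (0 : ℝ) ×ˢ localDomain φ e) ×ˢ univ) := by
  refine Complex.continuous_re.comp_continuousOn ?_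
  simp only [dotProduct, mulVec, Pi.star_apply]
  have hc : ∀ a, Continuous fun q : (ℝ × CSpace n) × (Fin r → ℂ) => q.2 a :=
    fun a => (continuous_apply a).comp continuous_snd
  refine continuousOn_finsetSum _ fun a _ => (hc a).star.continuousOn.mul
    (continuousOn_finsetSum _ fun b _ => ContinuousOn.mul ?_ (hc b).continuousOn)
  exact (hh.smooth φ hφ e a b).continuousOn.comp continuous_fst.continuousOn fun q hq => hq.1

variable [VectorBundle ℂ (CSpace r) E]

/-- Strict comparison of two solutions over a point is an open condition in space-time. -/
theorem eventually_lt (hg : IsDonaldsonFlow κ lam g) (hh : IsDonaldsonFlow κ lam h)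
    {μ : ℝ → ℝ} (hμ : Continuous μ) {t₀ : ℝ} (ht₀ : 0 ≤ t₀) {x₀ : X}
    (hlt : ∀ v : E x₀, v ≠ 0 →
      ((g t₀).form x₀ v v).re < μ t₀ * ((h t₀).form x₀ v v).re) :
    ∀ᶠ q : ℝ × X in nhds (t₀, x₀), 0 ≤ q.1 → ∀ v : E q.2, v ≠ 0 →
      ((g q.1).form q.2 v v).re < μ q.1 * ((h q.1).form q.2 v v).re := by
  set φ := chartAt (CSpace n) x₀
  have hφ : φ ∈ atlas (CSpace n) X := chart_mem_atlas _ _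
  set e := trivializationAt (CSpace r) E x₀
  have hx₀ : x₀ ∈ φ.source := mem_chart_source _ x₀
  have hinv : φ.symm (φ x₀) = x₀ := φ.left_inv hx₀
  have hxe : x₀ ∈ e.baseSet := mem_baseSet_trivializationAt _ _ x₀
  have hz : φ x₀ ∈ localDomain φ e := ⟨φ.map_source hx₀, by
    change φ.symm (φ x₀) ∈ e.baseSet
    rw [hinv]; exact hxe⟩
  have hopen := (isOpen_localDomain φ e).mem_nhds hz
  have hloc : ∀ᶠ p : ℝ × CSpace n in nhds (t₀, φ x₀), ∀ c ∈ Metric.sphere (0 : Fin r → ℂ) 1,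
      0 ≤ p.1 → p.2 ∈ localDomain φ e →
      (star c ⬝ᵥ (localMatrix (g p.1).form φ e p.2 *ᵥ c)).re
        < μ p.1 * (star c ⬝ᵥ (localMatrix (h p.1).form φ e p.2 *ᵥ c)).re := by
    -- Tube lemma: compactness of the sphere gives one space-time neighbourhood valid for all unit
    -- coefficient vectors.
    refine (isCompact_sphere (0 : Fin r → ℂ) 1).eventually_forall_of_forall_eventually
      fun c hc => ?_
    have hc0 : c ≠ 0 := by
      rintro rfl
      simp at hc
    have hmem : ((t₀, φ x₀), c) ∈ (Ici (0 : ℝ) ×ˢ localDomain φ e) ×ˢ (univ : Set (Fin r → ℂ)) :=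
      ⟨⟨ht₀, hz⟩, trivial⟩
    have h1 := hg.continuousOn_quadratic hφ e _ hmem
    have h2 := (hμ.comp (continuous_fst.comp continuous_fst)).continuousWithinAt.mul
      (hh.continuousOn_quadratic hφ e _ hmem)
    have hval : (star c ⬝ᵥ (localMatrix (g t₀).form φ e (φ x₀) *ᵥ c)).re
        < μ t₀ * (star c ⬝ᵥ (localMatrix (h t₀).form φ e (φ x₀) *ᵥ c)).re := by
      rw [localMatrix_quadratic, localMatrix_quadratic, hinv]
      exact hlt _ (sum_smul_localFrame_ne_zero e hxe hc0)
    have h3 := eventually_nhdsWithin_iff.1 (h1.eventually_lt h2 hval)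
    filter_upwards [h3] with q hq h0 hU
    exact hq ⟨⟨h0, hU⟩, trivial⟩
  have htend : Filter.Tendsto (fun q : ℝ × X => (q.1, φ q.2)) (nhds (t₀, x₀))
      (nhds (t₀, φ x₀)) :=
    (continuousAt_fst.prodMk ((φ.continuousAt hx₀).comp continuousAt_snd)).tendsto
  have hsrc : ∀ᶠ q : ℝ × X in nhds (t₀, x₀), q.2 ∈ φ.source ∧ q.2 ∈ e.baseSet :=
    (continuousAt_snd (p := (t₀, x₀))).tendsto.eventually
      ((φ.open_source.eventually_mem hx₀).and (e.open_baseSet.eventually_mem hxe))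
  filter_upwards [htend.eventually hloc, hsrc] with q hq hqs h0 v hv
  have hqinv : φ.symm (φ q.2) = q.2 := φ.left_inv hqs.1
  have hqU : φ q.2 ∈ localDomain φ e := ⟨φ.map_source hqs.1, by
    change φ.symm (φ q.2) ∈ e.baseSet
    rw [hqinv]; exact hqs.2⟩
  obtain ⟨c, rfl⟩ := exists_eq_sum_smul_localFrame e hqs.2 v
  have hc : c ≠ 0 := by
    rintro rfl
    simp at hv
  have h4 := quadratic_lt_of_sphere (fun c hc => hq c hc h0 hqU) hc
  rw [localMatrix_quadratic, localMatrix_quadratic, hqinv] at h4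
  exact h4

theorem continuousWithinAt_form (hh : IsDonaldsonFlow κ lam h) {t : ℝ} (ht : 0 ≤ t) (x : X)
    (v : E x) : ContinuousWithinAt (fun s => ((h s).form x v v).re) (Ici 0) t := by
  set φ := chartAt (CSpace n) x
  set e := trivializationAt (CSpace r) E x
  have hx : x ∈ φ.source := mem_chart_source _ x
  have hinv : φ.symm (φ x) = x := φ.left_inv hx
  have hxe : x ∈ e.baseSet := mem_baseSet_trivializationAt _ _ x
  have hz : φ x ∈ localDomain φ e := ⟨φ.map_source hx, by
    change φ.symm (φ x) ∈ e.baseSet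
    rw [hinv]; exact hxe⟩
  obtain ⟨c, rfl⟩ := exists_eq_sum_smul_localFrame e hxe v
  have h1 : ContinuousOn
      (fun s : ℝ => (star c ⬝ᵥ (localMatrix (h s).form φ e (φ x) *ᵥ c)).re) (Ici 0) :=
    (hh.continuousOn_quadratic (chart_mem_atlas _ x) e).comp
      (f := fun s : ℝ => ((s, φ x), c)) (by fun_prop) fun s hs => ⟨⟨hs, hz⟩, trivial⟩
  simp only [localMatrix_quadratic] at h1
  rw [hinv] at h1
  exact h1 t ht

/-- Continuity method: the infimum `t₀` of the bad times would itself be good, hence so would all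
times shortly after it. -/
theorem lt_of_initial_le [CompactSpace X] [IsManifold 𝓘(ℂ, CSpace n) ω X]
    (hg : IsDonaldsonFlow κ lam g) (hh : IsDonaldsonFlow κ lam h) (h0 : g 0 ≤ h 0)
    {ε : ℝ} (hε : 0 < ε) (t : ℝ) (ht : 0 ≤ t) (x : X) (v : E x) (hv : v ≠ 0) :
    ((g t).form x v v).re < (1 + ε * (1 + t)) * ((h t).form x v v).re := by
  let Good : ℝ → Prop := fun t => ∀ (x : X) (v : E x), v ≠ 0 →
    ((g t).form x v v).re < (1 + ε * (1 + t)) * ((h t).form x v v).re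
  have hopen : ∀ t, 0 ≤ t → Good t → ∀ᶠ s in nhds t, 0 ≤ s → Good s := fun t ht hG => by
    have h1 : ∀ᶠ s in nhds t, ∀ x ∈ (univ : Set X), 0 ≤ s → ∀ v : E x, v ≠ 0 →
        ((g s).form x v v).re < (1 + ε * (1 + s)) * ((h s).form x v v).re :=
      isCompact_univ.eventually_forall_of_forall_eventually fun x _ =>
        hg.eventually_lt hh (μ := fun s => 1 + ε * (1 + s)) (by fun_prop) ht (hG x)
    filter_upwards [h1] with s hs hs0 x using hs x trivial hs0
  -- The factor at time `0` is `1 + ε`, so the weak initial inequality becomes strict.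
  have hzero : Good 0 := fun x v hv => by
    have h1 := h0 x v
    have h2 := mul_pos hε ((h 0).pos x v hv)
    linarith
  suffices ∀ t, 0 ≤ t → Good t from this t ht x v hv
  by_contra! hbad
  set S : Set ℝ := {t | 0 ≤ t ∧ ¬ Good t}
  have hne : S.Nonempty := hbad
  have hbdd : BddBelow S := ⟨0, fun s hs => hs.1⟩
  set t₀ := sInf S
  have ht₀ : 0 ≤ t₀ := le_csInf hne fun s hs => hs.1
  have hbefore : ∀ s, 0 ≤ s → s < t₀ → Good s := fun s hs hlt => by
    by_contra hns
    exact (notMem_of_lt_csInf hlt hbdd) ⟨hs, hns⟩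
  have hgood : Good t₀ := by
    rcases ht₀.eq_or_lt with h00 | hpos
    · rw [← h00]; exact hzero
    have hle : ∀ s, 0 ≤ s → s ≤ t₀ → ∀ (x : X) (v : E x),
        ((g s).form x v v).re ≤ (1 + ε * (1 + s)) * ((h s).form x v v).re := by
      intro s hs hst x v
      rcases eq_or_ne v 0 with rfl | hv
      · simp
      rcases hst.lt_or_eq with hlt | rfl
      · exact (hbefore s hs hlt x v hv).le
      -- At `t₀` itself the weak inequality is the limit of the strict ones at earlier times;
      -- `no_first_touching` then excludes equality.
      have hsub : Ico 0 t₀ ⊆ Ici 0 := fun y hy => hy.1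
      have hcg := (hg.continuousWithinAt_form ht₀ x v).mono hsub
      have hch := (hh.continuousWithinAt_form ht₀ x v).mono hsub
      have hcμ : ContinuousWithinAt (fun t : ℝ => 1 + ε * (1 + t)) (Ico 0 t₀) t₀ :=
        Continuous.continuousWithinAt (by fun_prop)
      have : (nhdsWithin t₀ (Ico 0 t₀)).NeBot := by
        rw [← mem_closure_iff_nhdsWithin_neBot, closure_Ico hpos.ne]
        exact right_mem_Icc.2 ht₀
      refine le_of_tendsto_of_tendsto hcg (hcμ.mul hch) ?_
      filter_upwards [self_mem_nhdsWithin] with y hy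
      exact (hbefore y hy.1 hy.2 x v hv).le
    intro x v hv
    exact lt_of_le_of_ne (hle t₀ ht₀ le_rfl x v)
      (hg.no_first_touching hh hε hpos hle x v hv)
  obtain ⟨δ, hδ, hball⟩ := Metric.eventually_nhds_iff.1 (hopen t₀ ht₀ hgood)
  -- Some bad time lies in `[t₀, t₀ + δ)`, where every time is good.
  obtain ⟨s, hsS, hsδ⟩ := exists_lt_of_csInf_lt hne (lt_add_of_pos_right t₀ hδ)
  have hs₀ : t₀ ≤ s := csInf_le hbdd hsS
  refine hsS.2 (hball ?_ hsS.1)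
  rw [Real.dist_eq, abs_of_nonneg (sub_nonneg.2 hs₀)]
  linarith

end IsDonaldsonFlow

end Comparison

theorem mainTheorem2 {n r : ℕ}
    {X : Type*} [TopologicalSpace X] [T2Space X] [CompactSpace X]
    [ChartedSpace (CSpace n) X] [IsManifold 𝓘(ℂ, CSpace n) ω X]
    (κ : KahlerForm n X)
    {E : X → Type*} [TopologicalSpace (TotalSpace (CSpace r) E)] [∀ x, TopologicalSpace (E x)]
    [∀ x, AddCommGroup (E x)] [∀ x, Module ℂ (E x)]
    [FiberBundle (CSpace r) E] [VectorBundle ℂ (CSpace r) E]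
    [ContMDiffVectorBundle ω (CSpace r) E 𝓘(ℂ, CSpace n)]
    (lam : ℂ) (g h : ℝ → HermitianMetric n r E)
    (hg : IsDonaldsonFlow κ lam g) (hh : IsDonaldsonFlow κ lam h)
    (h0 : g 0 ≤ h 0) :
    ∀ t : ℝ, 0 ≤ t → g t ≤ h t := by
  intro t ht x v
  rcases eq_or_ne v 0 with rfl | hv
  · simp
  -- For fixed `t` and `v` the perturbed bound tends to `h(v, v)` as `ε` decreases to `0`.
  have hlim : Filter.Tendsto (fun ε : ℝ => (1 + ε * (1 + t)) * ((h t).form x v v).re)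
      (nhdsWithin 0 (Ioi 0)) (nhds (((h t).form x v v).re)) := by
    have hc : Continuous fun ε : ℝ => (1 + ε * (1 + t)) * ((h t).form x v v).re := by fun_prop
    have h1 := (hc.tendsto 0).mono_left (nhdsWithin_le_nhds (s := Ioi 0))
    simpa using h1
  refine ge_of_tendsto hlim ?_
  filter_upwards [self_mem_nhdsWithin] with ε hε
  exact (hg.lt_of_initial_le hh h0 hε t ht x v hv).le
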